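/- For $n\ge 1$ let $H_n^2=H_{1\times 2\times n}$ be the hexagonal grid graph (the double hexagonal line tiling) with vertices $v_1^1,\dots,v_{2n+1}^1$; $v_1^2,\dots,v_{2n+2}^2$; $v_1^3,\dots,v_{2n+1}^3$, and with the following edges: $\{v_r^i,v_{r+1}^i\}$ for any two consecutive vertices in the same row; $\{v_{2t-1}^1,v_{2t}^2\}$ for $1\le t\le n+1$; and $\{v_{2t-1}^2,v_{2t-1}^3\}$ for $1\le t\le n+1$. Let $Y_n=H_n^2\setminus\{v_{2n}^1,\,v_{2n+1}^1,\,v_{2n+2}^2\}$ be the induced subgraph obtained by deleting these three vertices. For a finite graph $G$ let $\operatorname{Ind}(G)$ be (the geometric realization of) its independence complex, whose faces are the independent sets of $G$. Write $\Sigma^k$ for the $k$-fold suspension and $\vee$ for the wedge sum, where suspensions are based at a suspension point. **Theorem.** For every $n\ge 1$, $$\operatorname{Ind}(H_n^2)\simeq\begin{cases} \mathbb S^2\vee\mathbb S^2, & n=1;\\ \mathbb S^4\vee\mathbb S^4\vee\mathbb S^4, & n=2;\\ \mathbb S^5\vee\mathbb S^6, & n=3;\\ \Sigma^6\operatorname{Ind}(Y_{n-3})\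 \vee\ \Sigma^4\operatorname{Ind}(Y_{n-2})\ \vee\ \Sigma^5\operatorname{Ind}(H_{n-3}^2), & n\ge 4, \end{cases}$$ where $\simeq$ denotes homotopy equivalence of topological spaces. -/

import Mathlib

open ContinuousMap

/-! ### Hexagonal grid graphs -/

/-- The number of vertices in the `i`-th row of the `1 × m × n` hexagonal grid graph:
`2n+1` in the first and in the last (`(m+1)`-st) row, and `2n+2` in all the others. -/
def hexRowLength (m n i : ℕ) : ℕ :=
  if i = 1 ∨ i = m + 1 then 2 * n + 1 else 2 * n + 2

/-- The vertices of the `1 × m × n` hexagonal grid graph. The pair `(i, r)` stands for the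
vertex `v_r^i`, where `1 ≤ i ≤ m+1` and `1 ≤ r ≤ hexRowLength m n i`. -/
def hexVertices (m n : ℕ) : Finset (ℕ × ℕ) :=
  (Finset.Icc 1 (m + 1) ×ˢ Finset.Icc 1 (2 * n + 2)).filter
    fun p => p.2 ≤ hexRowLength m n p.1

/-- The edges of the `1 × m × n` hexagonal grid graph, as a (non-symmetric) relation on labels:
* `v_r^j -- v_{r+1}^j` inside each row,
* `v_{2t-1}^k -- v_{2t}^{k+1}` for `k < m`,
* `v_{2t-1}^m -- v_{2t-1}^{m+1}`. -/
def hexRel (m : ℕ) (p q : ℕ × ℕ) : Prop :=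
  (q.1 = p.1 ∧ q.2 = p.2 + 1) ∨
  (p.1 < m ∧ q.1 = p.1 + 1 ∧ Odd p.2 ∧ q.2 = p.2 + 1) ∨
  (p.1 = m ∧ q.1 = m + 1 ∧ Odd p.2 ∧ q.2 = p.2)

/-- The hexagonal grid graph `H_{1 × m × n}`. -/
def hexGrid (m n : ℕ) : SimpleGraph (hexVertices m n) :=
  SimpleGraph.fromRel fun p q => hexRel m p.1 q.1

/-- The vertices of `H_{1 × 2 × n}` other than `v_{2n}^1`, `v_{2n+1}^1` and `v_{2n+2}^2`. -/
def graphYVertices (n : ℕ) : Set (hexVertices 2 n) :=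
  {v | v.1 ≠ (1, 2 * n) ∧ v.1 ≠ (1, 2 * n + 1) ∧ v.1 ≠ (2, 2 * n + 2)}

noncomputable instance graphYVerticesFintype (n : ℕ) : Fintype (graphYVertices n) :=
  Fintype.ofFinite _

/-- The graph `Y_n`: the induced subgraph of `H_{1 × 2 × n}` obtained by deleting
`v_{2n}^1`, `v_{2n+1}^1` and `v_{2n+2}^2`. -/
def graphY (n : ℕ) : SimpleGraph (graphYVertices n) :=
  (hexGrid 2 n).induce (graphYVertices n)

/-! ### Independence complexes and geometric realization -/

/-- The independence complex of a graph: its faces are the nonempty finite independent sets. -/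
def indComplex {V : Type} (G : SimpleGraph V) : AbstractSimplicialComplex V where
  faces := {s | s.Nonempty ∧ G.IsIndepSet (s : Set V)}
  isRelLowerSet_faces := fun _ hs =>
    ⟨hs.1, fun _ hts ht => ⟨ht, hs.2.mono (Finset.coe_subset.mpr hts)⟩⟩
  singleton_mem := fun v => ⟨Finset.singleton_nonempty v, by simp [SimpleGraph.IsIndepSet]⟩

/-- The geometric realization of a simplicial complex with finitely many vertices, in barycentric
coordinates: the union in `ℝ^V` of the closed simplices spanned by the faces. -/
def geomRealization {V : Type} [Fintype V] (K : AbstractSimplicialComplex V) : Set (V → ℝ) :=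
  {x | x ∈ stdSimplex ℝ V ∧ ∃ s ∈ K.faces, ∀ v, x v ≠ 0 → v ∈ s}

/-- The space `Ind(G)`: the geometric realization of the independence complex of `G`. -/
def IndSpace {V : Type} [Fintype V] (G : SimpleGraph V) : TopCat.{0} :=
  TopCat.of (geomRealization (indComplex G))

/-! ### Suspensions -/

/-- The identifications that make up the suspension: `X × {0}` is collapsed to one pole
(`false`) and `X × {1}` to the other pole (`true`). -/
inductive SuspensionRel (X : Type) : (X × unitInterval) ⊕ Bool → (X × unitInterval) ⊕ Bool → Prop
  | bot (x : X) : SuspensionRel X (Sum.inl (x, 0)) (Sum.inr false)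
  | top (x : X) : SuspensionRel X (Sum.inl (x, 1)) (Sum.inr true)

/-- The (unreduced) suspension of a space, as a quotient space; for nonempty `X` this is
`X × [0,1]` with `X × {0}` and `X × {1}` collapsed to one point each, and the suspension of the
empty space is the two-point space. -/
def Suspension (X : Type) : Type := Quot (SuspensionRel X)

instance (X : Type) [TopologicalSpace X] : TopologicalSpace (Suspension X) :=
  inferInstanceAs (TopologicalSpace (Quot (SuspensionRel X)))

/-- The `k`-fold iterated suspension `Σ^k X`. -/
def iteratedSuspension (X : TopCat.{0}) : ℕ → TopCat.{0}
  | 0 => X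
  | k + 1 => TopCat.of (Suspension (iteratedSuspension X k))

/-- The pole of the `k`-fold suspension (`k ≥ 1`) that belongs to the last suspension. -/
def suspensionPole (X : TopCat.{0}) : (k : ℕ) → k ≠ 0 → iteratedSuspension X k
  | 0, h => absurd rfl h
  | _ + 1, _ => Quot.mk _ (Sum.inr false)

/-! ### Pointed spaces, wedge sums, spheres -/

/-- A topological space with a base point. -/
structure PointedSpace where
  /-- the underlying space -/
  space : TopCat.{0}
  /-- the base point -/
  pt : space

/-- The `k`-fold suspension `Σ^k X`, for `k ≥ 1`, based at a pole. -/
def pointedSuspension (k : ℕ) [NeZero k] (X : TopCat.{0}) : PointedSpace where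
  space := iteratedSuspension X k
  pt := suspensionPole X k (NeZero.ne k)

/-- The identification of the two base points in a disjoint union. -/
inductive WedgeRel (A B : PointedSpace) : A.space ⊕ B.space → A.space ⊕ B.space → Prop
  | glue : WedgeRel A B (Sum.inl A.pt) (Sum.inr B.pt)

/-- The wedge sum `A ∨ B`: the disjoint union with the two base points identified. -/
def wedge (A B : PointedSpace) : PointedSpace where
  space := TopCat.of (Quot (WedgeRel A B))
  pt := Quot.mk _ (Sum.inl A.pt)

/-- The unit sphere `S^d` in `ℝ^{d+1}`, based at the first standard basis vector. -/
noncomputable def pointedSphere (d : ℕ) : PointedSpace where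
  space := TopCat.of (Metric.sphere (0 : EuclideanSpace ℝ (Fin (d + 1))) 1)
  pt := ⟨EuclideanSpace.single 0 1, by simp⟩

/-! For a vertex `v` of a graph, the independence complex is the mapping cone of the inclusion of
the link of `v` (the complex without the closed neighborhood of `v`) into the deletion of `v`; this
is `indConeHomeo`. The homotopy type of a mapping cone depends only on the homotopy class of the map
and on the homotopy types of its ends, which gives three rules. A vertex with contractible link can
be deleted (`indReal_deletion`). If the deletion is contractible, the complex is the suspension of
the link (`indReal_suspension`). If the link enters the deletion through a contractible subcomplex
and the deletion is path connected, the complex is the wedge of the deletion and the suspended link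
(`indReal_wedge`).

The second rule peels leaves: if `u` is a leaf attached to `w`, deleting `w` isolates `u` and leaves
a cone, so removing the closed neighborhood of `w` costs one suspension (`hexSpace_peel`).

For `n ≥ 4` the complex is split at `(2, 3)`. Its link peels in four moves to a translate of the
strip of length `n - 3`. Its deletion is split again at `(2, 2)`: the link peels in three moves, the
deletion in six, to half-turned copies of `graphY (n - 2)` and `graphY (n - 3)`. Each split turns
its link into a summand with one more suspension. Both inclusions are null-homotopic because an
intermediate induced subgraph peels to one with an isolated vertex. All moves take place in the
first few columns, so a single finite computation serves every `n ≥ 4`.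

For `n ≤ 3` the same rules peel down to the empty graph, whose complex is the empty space, and `d +
1` suspensions of the empty space give the sphere of dimension `d`. -/

/-! ### Mapping cones -/

section MappingCone

variable {L M A B Z : Type} [TopologicalSpace L] [TopologicalSpace M] [TopologicalSpace A]
  [TopologicalSpace B] [TopologicalSpace Z]

/-- The identifications that make up the mapping cone of `f : L → A`. -/
inductive MappingConeRel (f : C(L, A)) :
    (L × unitInterval) ⊕ (A ⊕ Unit) → (L × unitInterval) ⊕ (A ⊕ Unit) → Prop
  | base (x : L) : MappingConeRel f (Sum.inl (x, 0)) (Sum.inr (Sum.inl (f x)))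
  | tip (x : L) : MappingConeRel f (Sum.inl (x, 1)) (Sum.inr (Sum.inr ()))

/-- The (unreduced) mapping cone of `f : L → A`. -/
def MappingCone (f : C(L, A)) : Type := Quot (MappingConeRel f)

instance (f : C(L, A)) : TopologicalSpace (MappingCone f) :=
  inferInstanceAs (TopologicalSpace (Quot (MappingConeRel f)))

/-- The retraction of the real line onto the unit interval. -/
noncomputable def clampUnit : C(ℝ, unitInterval) := ⟨Set.projIcc 0 1 zero_le_one, continuous_projIcc⟩

lemma clampUnit_of_nonpos {t : ℝ} (h : t ≤ 0) : clampUnit t = 0 := Set.projIcc_of_le_left zero_le_one h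

lemma clampUnit_of_one_le {t : ℝ} (h : 1 ≤ t) : clampUnit t = 1 := Set.projIcc_of_right_le zero_le_one h

@[simp] lemma clampUnit_coe (t : unitInterval) : clampUnit (t : ℝ) = t := Set.projIcc_val zero_le_one t

@[simp] lemma clampUnit_zero : clampUnit 0 = 0 := clampUnit_of_nonpos le_rfl

@[simp] lemma clampUnit_one : clampUnit 1 = 1 := clampUnit_of_one_le le_rfl

namespace MappingCone

/-- The inclusion of the base into the mapping cone. -/
def inc (f : C(L, A)) : C(A, MappingCone f) :=
  ⟨fun a => Quot.mk _ (Sum.inr (Sum.inl a)),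
    continuous_quot_mk.comp (continuous_inr.comp continuous_inl)⟩

/-- The tip of the mapping cone. -/
def tip (f : C(L, A)) : MappingCone f := Quot.mk _ (Sum.inr (Sum.inr ()))

/-- The characteristic map of the cone, with its parameter clamped to the unit interval. -/
noncomputable def cone (f : C(L, A)) : C(L × ℝ, MappingCone f) :=
  ⟨fun p => Quot.mk _ (Sum.inl (p.1, clampUnit p.2)),
    continuous_quot_mk.comp (continuous_inl.comp (by fun_prop))⟩

/-- Because of the clamping, a reparametrization may run outside the unit interval: it then rests in
the base or at the tip. The homotopies below can thus be written with plain real formulas. -/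
lemma cone_of_nonpos (f : C(L, A)) (x : L) {t : ℝ} (h : t ≤ 0) : cone f (x, t) = inc f (f x) := by
  change Quot.mk _ (Sum.inl (x, clampUnit t)) = _
  rw [clampUnit_of_nonpos h]
  exact Quot.sound (MappingConeRel.base x)

lemma cone_of_one_le (f : C(L, A)) (x : L) {t : ℝ} (h : 1 ≤ t) : cone f (x, t) = tip f := by
  change Quot.mk _ (Sum.inl (x, clampUnit t)) = _
  rw [clampUnit_of_one_le h]
  exact Quot.sound (MappingConeRel.tip x)

@[simp] lemma cone_zero (f : C(L, A)) (x : L) : cone f (x, 0) = inc f (f x) :=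
  cone_of_nonpos f x le_rfl

@[simp] lemma cone_one (f : C(L, A)) (x : L) : cone f (x, 1) = tip f :=
  cone_of_one_le f x le_rfl

lemma ind {f : C(L, A)} {P : MappingCone f → Prop} (hA : ∀ a, P (inc f a))
    (hL : ∀ x (t : ℝ), 0 ≤ t → t ≤ 1 → P (cone f (x, t))) (ht : P (tip f)) (p : MappingCone f) :
    P p := by
  obtain ⟨p⟩ := p
  rcases p with ⟨x, t⟩ | a | u
  · have := hL x t t.2.1 t.2.2
    change P (Quot.mk _ (Sum.inl (x, clampUnit t))) at this
    rwa [clampUnit_coe] at this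
  · exact hA a
  · exact ht

/-- The map out of a mapping cone given by compatible maps on the base, the cone and the tip. -/
def desc {f : C(L, A)} (α : C(A, Z)) (β : C(L × ℝ, Z)) (z : Z) (h0 : ∀ x, β (x, 0) = α (f x))
    (h1 : ∀ x, β (x, 1) = z) : C(MappingCone f, Z) where
  toFun := Quot.lift (Sum.elim (fun p => β (p.1, (p.2 : ℝ))) (Sum.elim α fun _ => z)) (by
    rintro _ _ (⟨x⟩ | ⟨x⟩)
    · simpa using h0 x
    · simpa using h1 x)
  continuous_toFun := continuous_quot_lift _ (by fun_prop)

section desc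

variable {f : C(L, A)} (α : C(A, Z)) (β : C(L × ℝ, Z)) (z : Z) (h0 : ∀ x, β (x, 0) = α (f x))
  (h1 : ∀ x, β (x, 1) = z)

@[simp] lemma desc_inc (a : A) : desc α β z h0 h1 (inc f a) = α a := rfl

@[simp] lemma desc_tip : desc α β z h0 h1 (tip f) = z := rfl

lemma desc_cone (x : L) {t : ℝ} (ht0 : 0 ≤ t) (ht1 : t ≤ 1) :
    desc α β z h0 h1 (cone f (x, t)) = β (x, t) := by
  have : ((clampUnit t : unitInterval) : ℝ) = t := by
    simp [clampUnit, Set.projIcc_of_mem (zero_le_one' ℝ) ⟨ht0, ht1⟩]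
  change β (x, ((clampUnit t : unitInterval) : ℝ)) = _
  rw [this]

end desc

/-- Two maps out of a mapping cone are homotopic if they are joined by compatible homotopies on the
base, the cone and the tip. -/
lemma homotopic_of {f : C(L, A)} {F G : C(MappingCone f, Z)} (α : C(A × unitInterval, Z))
    (β : C((L × ℝ) × unitInterval, Z)) (γ : C(unitInterval, Z))
    (h0 : ∀ x s, β ((x, 0), s) = α (f x, s)) (h1 : ∀ x s, β ((x, 1), s) = γ s)
    (F0 : ∀ a, F (inc f a) = α (a, 0)) (F1 : ∀ x t, 0 ≤ t → t ≤ 1 → F (cone f (x, t)) = β ((x, t), 0))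
    (F2 : F (tip f) = γ 0)
    (G0 : ∀ a, G (inc f a) = α (a, 1)) (G1 : ∀ x t, 0 ≤ t → t ≤ 1 → G (cone f (x, t)) = β ((x, t), 1))
    (G2 : G (tip f) = γ 1) : F.Homotopic G := by
  -- The homotopy is built as a map into the path space, so that the universal property of the
  -- quotient applies directly; the product of a quotient map with the interval need not be
  -- examined.
  let H : C(MappingCone f, C(unitInterval, Z)) := desc α.curry β.curry γ
    (fun x => ContinuousMap.ext fun s => h0 x s) (fun x => ContinuousMap.ext fun s => h1 x s)
  refine ⟨⟨H.uncurry.comp ⟨Prod.swap, continuous_swap⟩, fun p => ?_, fun p => ?_⟩⟩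
  · change H p 0 = F p
    induction p using ind with
    | hA a => exact (F0 a).symm
    | hL x t a b => rw [F1 x t a b, desc_cone _ _ _ _ _ x a b]; rfl
    | ht => exact F2.symm
  · change H p 1 = G p
    induction p using ind with
    | hA a => exact (G0 a).symm
    | hL x t a b => rw [G1 x t a b, desc_cone _ _ _ _ _ x a b]; rfl
    | ht => exact G2.symm

/-- A self-map of a mapping cone that only reparametrizes the cone is homotopic to the identity. -/
lemma homotopic_id_of_reparam {f : C(L, A)} {F : C(MappingCone f, MappingCone f)} (ρ : C(ℝ, ℝ))
    (hρ0 : ρ 0 ≤ 0) (hρ1 : 1 ≤ ρ 1)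
    (hA : ∀ a, F (inc f a) = inc f a)
    (hL : ∀ x t, 0 ≤ t → t ≤ 1 → F (cone f (x, t)) = cone f (x, ρ t))
    (ht : F (tip f) = tip f) : F.Homotopic (ContinuousMap.id _) := by
  -- The straight line from `ρ` to the identity keeps the parameter at most 0 at the base and at
  -- least 1 at the tip.
  refine homotopic_of (α := (inc f).comp ⟨Prod.fst, continuous_fst⟩)
    (β := (cone f).comp ⟨fun p => (p.1.1, (1 - (p.2 : ℝ)) * ρ p.1.2 + p.2 * p.1.2), by fun_prop⟩)
    (γ := ContinuousMap.const _ (tip f)) ?_ ?_ ?_ ?_ ?_ ?_ ?_ ?_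
  · intro x s
    simp only [ContinuousMap.comp_apply, ContinuousMap.coe_mk]
    refine cone_of_nonpos f x ?_
    nlinarith [s.2.1, s.2.2]
  · intro x s
    simp only [ContinuousMap.comp_apply, ContinuousMap.coe_mk, ContinuousMap.const_apply]
    refine cone_of_one_le f x ?_
    nlinarith [s.2.1, s.2.2]
  · simpa using hA
  · intro x t h0 h1
    simp [hL x t h0 h1]
  · simpa using ht
  · simp
  · simp
  · simp

/-- The concatenation of a homotopy with the cone. -/
noncomputable def track {f g : C(L, A)} (H : f.Homotopy g) : C(L × ℝ, MappingCone g) where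
  toFun p := if p.2 ≤ 1 / 2 then inc g (H (clampUnit (2 * p.2), p.1)) else cone g (p.1, 2 * p.2 - 1)
  continuous_toFun := by
    refine Continuous.if_le (by fun_prop) (by fun_prop) (by fun_prop) (by fun_prop) ?_
    rintro ⟨x, t⟩ h
    simp only at h
    subst h
    norm_num

/-- The map of mapping cones induced by a homotopy. -/
noncomputable def ofHomotopy {f g : C(L, A)} (H : f.Homotopy g) : C(MappingCone f, MappingCone g) :=
  desc (inc g) (track H) (tip g) (fun x => by simp [track]) (fun x => by norm_num [track])

lemma ofHomotopy_inc {f g : C(L, A)} (H : f.Homotopy g) (a : A) :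
    ofHomotopy H (inc f a) = inc g a := rfl

lemma ofHomotopy_cone {f g : C(L, A)} (H : f.Homotopy g) (x : L) {t : ℝ} (h0 : 0 ≤ t) (h1 : t ≤ 1) :
    ofHomotopy H (cone f (x, t)) =
      if t ≤ 1 / 2 then inc g (H (clampUnit (2 * t), x)) else cone g (x, 2 * t - 1) :=
  desc_cone _ _ _ _ _ x h0 h1

/-- Along a cone line the composite runs `H` forward until time 1/2, backward until 3/4, and then
traverses the cone at speed four. The excursion reaches `min (2t) (3 - 4t)`; scaling it by `1 - s`
contracts it to the starting point and leaves the reparametrization `R`. -/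
lemma ofHomotopy_symm_comp {f g : C(L, A)} (H : f.Homotopy g) :
    ((ofHomotopy H.symm).comp (ofHomotopy H)).Homotopic (ContinuousMap.id _) := by
  let R : C(MappingCone f, MappingCone f) := desc (inc f)
    ((cone f).comp ⟨fun p => (p.1, 4 * p.2 - 3), by fun_prop⟩) (tip f)
    (fun x => cone_of_nonpos f x (by norm_num)) (fun x => cone_of_one_le f x (by norm_num))
  have hR : R.Homotopic (ContinuousMap.id _) :=
    homotopic_id_of_reparam ⟨fun t => 4 * t - 3, by fun_prop⟩ (by norm_num) (by norm_num)
      (fun a => rfl) (fun x t h0 h1 => desc_cone _ _ _ _ _ x h0 h1) rfl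
  refine ContinuousMap.Homotopic.trans ?_ hR
  refine homotopic_of (α := (inc f).comp ⟨Prod.fst, continuous_fst⟩)
    (β := ⟨fun p => if p.1.2 ≤ 3 / 4
        then inc f (H (clampUnit ((1 - (p.2 : ℝ)) * min (2 * p.1.2) (3 - 4 * p.1.2)), p.1.1))
        else cone f (p.1.1, 4 * p.1.2 - 3), ?_⟩)
    (γ := ContinuousMap.const _ (tip f)) ?_ ?_ ?_ ?_ ?_ ?_ ?_ ?_
  · refine Continuous.if_le (by fun_prop) (by fun_prop) (by fun_prop) (by fun_prop) ?_
    rintro ⟨⟨x, t⟩, s⟩ h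
    simp only at h
    subst h
    norm_num
  · intro x s
    simp [show ¬ ((3 : ℝ) / 4 < 0) by norm_num]
  · intro x s
    norm_num
  · intro a
    rfl
  · intro x t h0 h1
    simp only [ContinuousMap.comp_apply, ofHomotopy_cone H x h0 h1, ContinuousMap.coe_mk]
    by_cases h : t ≤ 1 / 2
    · rw [if_pos h, if_pos (by linarith), ofHomotopy_inc, min_eq_left (by linarith)]
      simp
    · rw [if_neg h, ofHomotopy_cone _ x (by linarith) (by linarith)]
      by_cases h' : t ≤ 3 / 4
      · rw [if_pos h', if_pos (by linarith), min_eq_right (by linarith),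
          ContinuousMap.Homotopy.symm_apply]
        congr 3
        apply Subtype.ext
        have e1 : ((clampUnit (2 * (2 * t - 1)) : unitInterval) : ℝ) = 2 * (2 * t - 1) := by
          simp only [clampUnit, ContinuousMap.coe_mk]
          rw [Set.projIcc_of_mem (zero_le_one' ℝ) ⟨by linarith, by linarith⟩]
        have e2 : ((clampUnit (3 - 4 * t) : unitInterval) : ℝ) = 3 - 4 * t := by
          simp only [clampUnit, ContinuousMap.coe_mk]
          rw [Set.projIcc_of_mem (zero_le_one' ℝ) ⟨by linarith, by linarith⟩]
        simp only [unitInterval.coe_symm_eq, e1, Set.Icc.coe_zero, sub_zero, one_mul, e2]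
        ring
      · rw [if_neg h', if_neg (by linarith)]
        congr 2
        ring
  · rfl
  · intro a
    rfl
  · intro x t h0 h1
    rw [show R (cone f (x, t)) = cone f (x, 4 * t - 3) from desc_cone _ _ _ _ _ x h0 h1]
    simp only [ContinuousMap.coe_mk]
    by_cases h : t ≤ 3 / 4
    · rw [if_pos h, cone_of_nonpos f x (by linarith)]
      simp
    · rw [if_neg h]
  · rfl

/-- Homotopic maps have homotopy equivalent mapping cones. -/
noncomputable def equivOfHomotopy {f g : C(L, A)} (H : f.Homotopy g) :
    MappingCone f ≃ₕ MappingCone g where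
  toFun := ofHomotopy H
  invFun := ofHomotopy H.symm
  left_inv := ofHomotopy_symm_comp H
  right_inv := by simpa using ofHomotopy_symm_comp H.symm

/-- The map of mapping cones induced by a map of the bases. -/
noncomputable def mapBase (f : C(L, A)) (h : C(A, B)) : C(MappingCone f, MappingCone (h.comp f)) :=
  desc ((inc _).comp h) (cone _) (tip _) (fun x => by simp) (fun x => by simp)

lemma mapBase_cone (f : C(L, A)) (h : C(A, B)) (x : L) {t : ℝ} (h0 : 0 ≤ t) (h1 : t ≤ 1) :
    mapBase f h (cone f (x, t)) = cone _ (x, t) := desc_cone _ _ _ _ _ x h0 h1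

/-- The map of mapping cones induced by a map of the sources. -/
noncomputable def mapSource (k : C(M, L)) (f : C(L, A)) :
    C(MappingCone (f.comp k), MappingCone f) :=
  desc (inc f) ((cone f).comp ⟨fun p => (k p.1, p.2), by fun_prop⟩) (tip f) (fun x => by simp)
    (fun x => by simp)

lemma mapSource_cone (k : C(M, L)) (f : C(L, A)) (x : M) {t : ℝ} (h0 : 0 ≤ t) (h1 : t ≤ 1) :
    mapSource k f (cone _ (x, t)) = cone f (k x, t) := desc_cone _ _ _ _ _ x h0 h1

/-- The homotopy `k ∘ f ≃ f` obtained from `k ≃ id`. -/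
def homotopyCompLeft {k : C(A, A)} (H : k.Homotopy (ContinuousMap.id A)) (f : C(L, A)) :
    (k.comp f).Homotopy f where
  toFun p := H (p.1, f p.2)
  continuous_toFun := by fun_prop
  map_zero_left x := by simp
  map_one_left x := by simp

/-- The homotopy `f ≃ f ∘ k` obtained from `k ≃ id`. -/
def homotopyCompRight {k : C(L, L)} (H : k.Homotopy (ContinuousMap.id L)) (f : C(L, A)) :
    f.Homotopy (f.comp k) where
  toFun p := f (H (unitInterval.symm p.1, p.2))
  continuous_toFun := by fun_prop
  map_zero_left x := by simp
  map_one_left x := by simp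

/-- The composite is `h' ∘ h` on the base; on a cone line it first follows `H` back to `f x` and
then the cone at double speed. Moving the base along `H` up to time `s` is compensated by starting
the excursion at time `s`, whence the clamped parameter `s + 2t`. -/
lemma mapBase_leftInverse (f : C(L, A)) (h : C(A, B)) (h' : C(B, A))
    (H : (h'.comp h).Homotopy (ContinuousMap.id A)) :
    (((ofHomotopy (homotopyCompLeft H f)).comp (mapBase (h.comp f) h')).comp
      (mapBase f h)).Homotopic (ContinuousMap.id _) := by
  let R : C(MappingCone f, MappingCone f) := desc (inc f)
    ((cone f).comp ⟨fun p => (p.1, 2 * p.2 - 1), by fun_prop⟩) (tip f)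
    (fun x => cone_of_nonpos f x (by norm_num)) (fun x => cone_of_one_le f x (by norm_num))
  have hR : R.Homotopic (ContinuousMap.id _) :=
    homotopic_id_of_reparam ⟨fun t => 2 * t - 1, by fun_prop⟩ (by norm_num) (by norm_num)
      (fun a => rfl) (fun x t h0 h1 => desc_cone _ _ _ _ _ x h0 h1) rfl
  refine ContinuousMap.Homotopic.trans ?_ hR
  refine homotopic_of (α := (inc f).comp ⟨fun p => H (p.2, p.1), by fun_prop⟩)
    (β := ⟨fun p => if p.1.2 ≤ 1 / 2
        then inc f (H (clampUnit ((p.2 : ℝ) + 2 * p.1.2), f p.1.1))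
        else cone f (p.1.1, 2 * p.1.2 - 1), ?_⟩)
    (γ := ContinuousMap.const _ (tip f)) ?_ ?_ ?_ ?_ ?_ ?_ ?_ ?_
  · refine Continuous.if_le (by fun_prop) (by fun_prop) (by fun_prop) (by fun_prop) ?_
    rintro ⟨⟨x, t⟩, s⟩ h
    simp only at h
    subst h
    rw [clampUnit_of_one_le (by linarith [s.2.1])]
    norm_num
  · intro x s
    simp
  · intro x s
    norm_num
  · intro a
    simp [mapBase, ofHomotopy_inc]
  · intro x t h0 h1
    simp only [ContinuousMap.comp_apply]
    rw [mapBase_cone f h x h0 h1]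
    erw [mapBase_cone (h.comp f) h' x h0 h1]
    refine (ofHomotopy_cone (homotopyCompLeft H f) x h0 h1).trans ?_
    simp only [ContinuousMap.coe_mk, Set.Icc.coe_zero, zero_add]
    rfl
  · rfl
  · intro a
    simp [R]
  · intro x t h0 h1
    rw [show R (cone f (x, t)) = cone f (x, 2 * t - 1) from desc_cone _ _ _ _ _ x h0 h1]
    simp only [ContinuousMap.coe_mk]
    by_cases h : t ≤ 1 / 2
    · rw [if_pos h, cone_of_nonpos f x (by linarith),
        clampUnit_of_one_le (by simp only [Set.Icc.coe_one]; linarith)]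
      simp
    · rw [if_neg h]
  · rfl

/-- The composite fixes the base; on a cone line it follows `f ∘ H` backward from `f x` to `f (k (k'
x))`, then the cone over `k (k' x)`. Stopping the excursion at time `s`, by means of `max (1 - 2t)
s`, and continuing on the cone over `H (s, x)` deforms it to a reparametrization. -/
lemma mapSource_rightInverse (k : C(M, L)) (k' : C(L, M)) (f : C(L, A))
    (H : (k.comp k').Homotopy (ContinuousMap.id L)) :
    ((mapSource k f).comp ((mapSource k' (f.comp k)).comp
      (ofHomotopy (homotopyCompRight H f)))).Homotopic (ContinuousMap.id _) := by
  let R : C(MappingCone f, MappingCone f) := desc (inc f)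
    ((cone f).comp ⟨fun p => (p.1, 2 * p.2 - 1), by fun_prop⟩) (tip f)
    (fun x => cone_of_nonpos f x (by norm_num)) (fun x => cone_of_one_le f x (by norm_num))
  have hR : R.Homotopic (ContinuousMap.id _) :=
    homotopic_id_of_reparam ⟨fun t => 2 * t - 1, by fun_prop⟩ (by norm_num) (by norm_num)
      (fun a => rfl) (fun x t h0 h1 => desc_cone _ _ _ _ _ x h0 h1) rfl
  refine ContinuousMap.Homotopic.trans ?_ hR
  refine homotopic_of (α := (inc f).comp ⟨Prod.fst, continuous_fst⟩)
    (β := ⟨fun p => if p.1.2 ≤ 1 / 2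
        then inc f (f (H (clampUnit (max (1 - 2 * p.1.2) (p.2 : ℝ)), p.1.1)))
        else cone f (H (p.2, p.1.1), 2 * p.1.2 - 1), ?_⟩)
    (γ := ContinuousMap.const _ (tip f)) ?_ ?_ ?_ ?_ ?_ ?_ ?_ ?_
  · refine Continuous.if_le (by fun_prop) (by fun_prop) (by fun_prop) (by fun_prop) ?_
    rintro ⟨⟨x, t⟩, s⟩ h
    simp only at h
    subst h
    have : max (1 - 2 * (1 / 2 : ℝ)) (s : ℝ) = s := by
      rw [max_eq_right]; linarith [s.2.1]
    rw [this]
    norm_num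
  · intro x s
    simp only [ContinuousMap.coe_mk]
    rw [if_pos (by norm_num), max_eq_left (by linarith [s.2.2]), clampUnit_of_one_le (by norm_num)]
    simp
  · intro x s
    norm_num
  · intro a
    rfl
  · intro x t h0 h1
    simp only [ContinuousMap.comp_apply, ContinuousMap.coe_mk]
    rw [ofHomotopy_cone _ x h0 h1]
    by_cases h : t ≤ 1 / 2
    · rw [if_pos h, if_pos h]
      change inc f (f (H (unitInterval.symm _, x))) = _
      congr 4
      apply Subtype.ext
      have e1 : ((clampUnit (2 * t) : unitInterval) : ℝ) = 2 * t := by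
        simp only [clampUnit, ContinuousMap.coe_mk]
        rw [Set.projIcc_of_mem (zero_le_one' ℝ) ⟨by linarith, by linarith⟩]
      have e2 : ((clampUnit (1 - 2 * t) : unitInterval) : ℝ) = 1 - 2 * t := by
        simp only [clampUnit, ContinuousMap.coe_mk]
        rw [Set.projIcc_of_mem (zero_le_one' ℝ) ⟨by linarith, by linarith⟩]
      rw [Set.Icc.coe_zero, max_eq_left (by linarith)]
      rw [unitInterval.coe_symm_eq, e1, e2]
    · rw [if_neg h, if_neg h]
      erw [mapSource_cone k' (f.comp k) x (by linarith) (by linarith)]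
      rw [mapSource_cone k f _ (by linarith) (by linarith)]
      simp
  · rfl
  · intro a
    rfl
  · intro x t h0 h1
    rw [show R (cone f (x, t)) = cone f (x, 2 * t - 1) from desc_cone _ _ _ _ _ x h0 h1]
    simp only [ContinuousMap.coe_mk]
    by_cases h : t ≤ 1 / 2
    · rw [if_pos h, cone_of_nonpos f x (by linarith), Set.Icc.coe_one, max_eq_right (by linarith)]
      simp
    · rw [if_neg h]
      simp
  · rfl

end MappingCone

/-- A map with a left and a right homotopy inverse is a homotopy equivalence. -/
lemma nonempty_homotopyEquiv_of_inverses {X Y : Type} [TopologicalSpace X] [TopologicalSpace Y]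
    (f : C(X, Y)) (g h : C(Y, X)) (hg : (g.comp f).Homotopic (ContinuousMap.id X))
    (hh : (f.comp h).Homotopic (ContinuousMap.id Y)) : Nonempty (X ≃ₕ Y) := by
  have key : g.Homotopic h := by
    have h1 : (g.comp (f.comp h)).Homotopic g := by
      simpa using (ContinuousMap.Homotopic.refl g).comp hh
    have h2 : ((g.comp f).comp h).Homotopic h := by
      simpa using hg.comp (ContinuousMap.Homotopic.refl h)
    exact h1.symm.trans h2
  exact ⟨⟨f, g, hg, ((ContinuousMap.Homotopic.refl f).comp key).trans hh⟩⟩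

namespace MappingCone

/-- `mapBase_leftInverse` produces left inverses only. Used for `h` it shows that `φ` is a right
inverse of `E ∘ φ'`; used for the inverse of `h` it gives a left inverse of `φ'`, hence of `E ∘ φ'`.
-/
lemma nonempty_equiv_base (f : C(L, A)) (h : A ≃ₕ B) :
    Nonempty (MappingCone f ≃ₕ MappingCone (h.toFun.comp f)) := by
  obtain ⟨H⟩ := h.left_inv
  obtain ⟨K⟩ := h.right_inv
  let E := equivOfHomotopy (homotopyCompLeft H f)
  have hl := mapBase_leftInverse f h.toFun h.invFun H
  have hl' := mapBase_leftInverse (h.toFun.comp f) h.invFun h.toFun K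
  set φ := mapBase f h.toFun
  set φ' := mapBase (h.toFun.comp f) h.invFun
  set σ := (ofHomotopy (homotopyCompLeft K (h.toFun.comp f))).comp
    (mapBase (h.invFun.comp (h.toFun.comp f)) h.toFun)
  refine (nonempty_homotopyEquiv_of_inverses (E.toFun.comp φ') (σ.comp E.invFun) φ ?_ hl).map
    ContinuousMap.HomotopyEquiv.symm
  have : ((σ.comp (E.invFun.comp E.toFun)).comp φ').Homotopic (σ.comp φ') := by
    simpa using ((ContinuousMap.Homotopic.refl σ).comp E.left_inv).comp
      (ContinuousMap.Homotopic.refl φ')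
  exact this.trans hl'

/-- Dual to `nonempty_equiv_base`: here two right inverses are combined into a two-sided one. -/
lemma nonempty_equiv_source (f : C(L, A)) (k : M ≃ₕ L) :
    Nonempty (MappingCone f ≃ₕ MappingCone (f.comp k.toFun)) := by
  obtain ⟨H⟩ := k.left_inv
  obtain ⟨K⟩ := k.right_inv
  let E := equivOfHomotopy (homotopyCompRight K f)
  have hl := mapSource_rightInverse k.toFun k.invFun f K
  have hl' := mapSource_rightInverse k.invFun k.toFun (f.comp k.toFun) H
  set φ := mapSource k.toFun f
  set φ' := mapSource k.invFun (f.comp k.toFun)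
  set σ := (mapSource k.toFun ((f.comp k.toFun).comp k.invFun)).comp
    (ofHomotopy (homotopyCompRight H (f.comp k.toFun)))
  refine nonempty_homotopyEquiv_of_inverses (φ'.comp E.toFun) φ (E.invFun.comp σ) hl ?_
  have : (φ'.comp ((E.toFun.comp E.invFun).comp σ)).Homotopic (φ'.comp σ) := by
    simpa using (ContinuousMap.Homotopic.refl φ').comp
      (E.right_inv.comp (ContinuousMap.Homotopic.refl σ))
  exact this.trans hl'

lemma nonempty_equiv_of_homotopic {f g : C(L, A)} (h : f.Homotopic g) :
    Nonempty (MappingCone f ≃ₕ MappingCone g) :=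
  h.map equivOfHomotopy

end MappingCone
end MappingCone

/-! ### Suspensions and wedges as mapping cones -/

namespace MappingCone

variable {L M A B : Type} [TopologicalSpace L] [TopologicalSpace M] [TopologicalSpace A]
  [TopologicalSpace B]

/-- The mapping cone of a map with contractible source is equivalent to the target. -/
lemma nonempty_equiv_of_contractible_source [ContractibleSpace L] (f : C(L, A)) :
    Nonempty (A ≃ₕ MappingCone f) := by
  obtain ⟨k⟩ := ContractibleSpace.hequiv_unit L
  obtain ⟨e⟩ := nonempty_equiv_source f k.symm
  set g := f.comp k.symm.toFun
  -- Once the source is a point, the cone is a whisker attached to `A`, which is pulled down along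
  -- itself.
  refine ⟨ContinuousMap.HomotopyEquiv.trans ⟨inc g, desc (ContinuousMap.id A)
    ⟨fun _ => g (), by fun_prop⟩ (g ()) (fun _ => rfl) (fun _ => rfl), ?_, ?_⟩ e.symm⟩
  · exact ContinuousMap.Homotopic.refl _
  · refine homotopic_of (α := (inc g).comp ⟨Prod.fst, continuous_fst⟩)
      (β := (cone g).comp ⟨fun p => ((), p.1.2 * (p.2 : ℝ)), by fun_prop⟩)
      (γ := (cone g).comp ⟨fun s => ((), (s : ℝ)), by fun_prop⟩) ?_ ?_ ?_ ?_ ?_ ?_ ?_ ?_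
    · intro x s; simp
    · intro x s; simp
    · intro a; rfl
    · intro x t h0 h1
      refine (congrArg (inc g) (desc_cone _ _ _ _ _ x h0 h1)).trans ?_
      simp
    · simp only [ContinuousMap.comp_apply, ContinuousMap.coe_mk, Set.Icc.coe_zero, cone_zero]
      rfl
    · intro a; rfl
    · intro x t h0 h1; simp
    · simp

/-- The mapping cone of the map to a point is the suspension. -/
noncomputable def constUnitHomeo (L : Type) [TopologicalSpace L] :
    MappingCone (ContinuousMap.const L ()) ≃ₜ Suspension L where
  toFun := Quot.lift (Sum.elim (fun p => Quot.mk _ (Sum.inl p))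
    (Sum.elim (fun _ => Quot.mk _ (Sum.inr false)) fun _ => Quot.mk _ (Sum.inr true))) (by
      rintro _ _ (⟨x⟩ | ⟨x⟩)
      · exact Quot.sound (SuspensionRel.bot x)
      · exact Quot.sound (SuspensionRel.top x))
  invFun := Quot.lift (Sum.elim (fun p => Quot.mk _ (Sum.inl p))
    (fun b => Quot.mk _ (Sum.inr (if b then Sum.inr () else Sum.inl ())))) (by
      rintro _ _ (⟨x⟩ | ⟨x⟩)
      · exact Quot.sound (MappingConeRel.base x)
      · exact Quot.sound (MappingConeRel.tip x))
  left_inv := by rintro ⟨_ | _ | _⟩ <;> rfl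
  right_inv := by rintro ⟨_ | _ | _⟩ <;> rfl
  continuous_toFun := continuous_quot_lift _ (by
    refine Continuous.sumElim (continuous_quot_mk.comp continuous_inl) (by fun_prop))
  continuous_invFun := continuous_quot_lift _ (by
    refine Continuous.sumElim (continuous_quot_mk.comp continuous_inl)
      (continuous_of_discreteTopology))

/-- The pointed suspension of a space. -/
def _root_.suspensionPointed (L : Type) [TopologicalSpace L] : PointedSpace where
  space := TopCat.of (Suspension L)
  pt := Quot.mk _ (Sum.inr false)

/-- The mapping cone of a constant map is a wedge with a suspension. -/
def constHomeo (L : Type) [TopologicalSpace L] (P : PointedSpace) :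
    MappingCone (ContinuousMap.const L P.pt) ≃ₜ (wedge P (suspensionPointed L)).space where
  toFun := Quot.lift (Sum.elim (fun p => Quot.mk _ (Sum.inr (Quot.mk _ (Sum.inl p))))
    (Sum.elim (fun a => Quot.mk _ (Sum.inl a))
      fun _ => Quot.mk _ (Sum.inr (Quot.mk _ (Sum.inr true))))) (by
      rintro _ _ (⟨x⟩ | ⟨x⟩)
      · have h : (Quot.mk (SuspensionRel L) (Sum.inl (x, 0))) = Quot.mk _ (Sum.inr false) :=
          Quot.sound (SuspensionRel.bot x)
        exact (congrArg (fun z => Quot.mk (WedgeRel P (suspensionPointed L)) (Sum.inr z)) h).trans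
          (Quot.sound WedgeRel.glue).symm
      · have h : (Quot.mk (SuspensionRel L) (Sum.inl (x, 1))) = Quot.mk _ (Sum.inr true) :=
          Quot.sound (SuspensionRel.top x)
        exact congrArg (fun z => Quot.mk (WedgeRel P (suspensionPointed L)) (Sum.inr z)) h)
  invFun := Quot.lift (Sum.elim (fun a => Quot.mk _ (Sum.inr (Sum.inl a)))
    (Quot.lift (Sum.elim (fun p => Quot.mk _ (Sum.inl p))
      (fun b => Quot.mk _ (Sum.inr (if b then Sum.inr () else Sum.inl P.pt)))) (by
        rintro _ _ (⟨x⟩ | ⟨x⟩)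
        · exact Quot.sound (MappingConeRel.base x)
        · exact Quot.sound (MappingConeRel.tip x)))) (by rintro _ _ ⟨⟩; rfl)
  left_inv := by rintro ⟨_ | _ | _⟩ <;> rfl
  right_inv := by
    rintro ⟨a | ⟨⟨p | b⟩⟩⟩
    · rfl
    · rfl
    · cases b
      · exact Quot.sound WedgeRel.glue
      · rfl
  continuous_toFun := continuous_quot_lift _ (by
    refine Continuous.sumElim (continuous_quot_mk.comp (continuous_inr.comp
      (continuous_quot_mk.comp continuous_inl))) (Continuous.sumElim
      (continuous_quot_mk.comp continuous_inl) continuous_const))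
  continuous_invFun := continuous_quot_lift _ (by
    refine Continuous.sumElim (continuous_quot_mk.comp (continuous_inr.comp continuous_inl))
      (continuous_quot_lift _ ?_)
    refine Continuous.sumElim (continuous_quot_mk.comp continuous_inl)
      (continuous_of_discreteTopology))

/-- The mapping cone of a map with contractible target is equivalent to the suspension. -/
lemma nonempty_equiv_suspension [ContractibleSpace A] (f : C(L, A)) :
    Nonempty (MappingCone f ≃ₕ Suspension L) := by
  obtain ⟨k⟩ := ContractibleSpace.hequiv_unit A
  obtain ⟨e⟩ := nonempty_equiv_base f k
  exact ⟨e.trans (constUnitHomeo L).toHomotopyEquiv⟩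

/-- Homotopy equivalent spaces have homotopy equivalent suspensions. -/
lemma _root_.Suspension.nonempty_congr (e : L ≃ₕ M) :
    Nonempty (Suspension L ≃ₕ Suspension M) := by
  obtain ⟨h⟩ := nonempty_equiv_source (ContinuousMap.const M ()) e
  exact ⟨((constUnitHomeo L).symm.toHomotopyEquiv.trans h.symm).trans
    (constUnitHomeo M).toHomotopyEquiv⟩

/-- The mapping cone of a null-homotopic map into a path-connected space splits. -/
lemma nonempty_equiv_wedge {f : C(L, A)} (hf : f.Nullhomotopic) {P : PointedSpace}
    [PathConnectedSpace P.space] (eA : A ≃ₕ P.space) (eL : L ≃ₕ M) :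
    Nonempty (MappingCone f ≃ₕ (wedge P (suspensionPointed M)).space) := by
  obtain ⟨a, hf⟩ := hf
  obtain ⟨e1⟩ := nonempty_equiv_of_homotopic hf
  obtain ⟨e2⟩ := nonempty_equiv_base (ContinuousMap.const L a) eA
  obtain ⟨e3⟩ := nonempty_equiv_source (eA.toFun.comp (ContinuousMap.const L a)) eL.symm
  -- The null-homotopy ends at an uncontrolled point; a path moves this point to the base point of
  -- the wedge.
  obtain ⟨γ⟩ := PathConnectedSpace.joined (eA a) P.pt
  have hom : ((eA.toFun.comp (ContinuousMap.const L a)).comp eL.symm.toFun).Homotopic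
      (ContinuousMap.const M P.pt) :=
    ⟨⟨⟨fun p => γ p.1, by fun_prop⟩, fun x => γ.source, fun x => γ.target⟩⟩
  obtain ⟨e4⟩ := nonempty_equiv_of_homotopic hom
  exact ⟨(((e1.trans e2).trans e3).trans e4).trans (constHomeo M P).toHomotopyEquiv⟩

end MappingCone

/-! ### Path connectedness and contractibility of suspensions and wedges -/

section PathConnected

/-- The suspension of a nonempty space is path connected. -/
lemma Suspension.pathConnectedSpace (X : Type) [TopologicalSpace X] [Nonempty X] :
    PathConnectedSpace (Suspension X) := by
  have hmk : Continuous (Quot.mk (SuspensionRel X)) := continuous_quot_mk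
  have : PathConnectedSpace unitInterval :=
    isPathConnected_iff_pathConnectedSpace.mp ((convex_Icc (0 : ℝ) 1).isPathConnected ⟨0, by simp⟩)
  have hj : ∀ (x : X) (t : unitInterval),
      Joined (Quot.mk (SuspensionRel X) (Sum.inl (x, t))) (Quot.mk _ (Sum.inr false)) := by
    intro x t
    have h0 : (Quot.mk (SuspensionRel X) (Sum.inl (x, 0))) = Quot.mk _ (Sum.inr false) :=
      Quot.sound (SuspensionRel.bot x)
    rw [← h0]
    exact (PathConnectedSpace.joined t 0).map (f := fun s => Quot.mk (SuspensionRel X) (Sum.inl (x, s)))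
      (hmk.comp (continuous_inl.comp (by fun_prop)))
  have hp : ∀ p : Suspension X, Joined p (Quot.mk _ (Sum.inr false)) := by
    rintro ⟨⟨x, t⟩ | b⟩
    · exact hj x t
    · cases b
      · exact Joined.refl _
      · obtain ⟨x⟩ := ‹Nonempty X›
        have h1 : (Quot.mk (SuspensionRel X) (Sum.inl (x, 1))) = Quot.mk _ (Sum.inr true) :=
          Quot.sound (SuspensionRel.top x)
        have := hj x 1
        rwa [h1] at this
  exact ⟨⟨Quot.mk _ (Sum.inr false)⟩, fun p q => (hp p).trans (hp q).symm⟩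

lemma iteratedSuspension_nonempty (X : TopCat.{0}) [Nonempty X] (k : ℕ) :
    Nonempty (iteratedSuspension X k) := by
  cases k with
  | zero => assumption
  | succ k => exact ⟨Quot.mk _ (Sum.inr false)⟩

lemma iteratedSuspension_pathConnectedSpace (X : TopCat.{0}) [Nonempty X] (k : ℕ) :
    PathConnectedSpace (iteratedSuspension X (k + 1)) :=
  have := iteratedSuspension_nonempty X k
  Suspension.pathConnectedSpace _

lemma wedge_pathConnectedSpace (P Q : PointedSpace) [PathConnectedSpace P.space]
    [PathConnectedSpace Q.space] : PathConnectedSpace (wedge P Q).space := by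
  have hmk : Continuous (Quot.mk (WedgeRel P Q)) := continuous_quot_mk
  have hp : ∀ p : (wedge P Q).space, Joined p (wedge P Q).pt := by
    rintro ⟨a | b⟩
    · exact (PathConnectedSpace.joined a P.pt).map
        (f := fun s => Quot.mk (WedgeRel P Q) (Sum.inl s)) (hmk.comp continuous_inl)
    · have h : (wedge P Q).pt = Quot.mk (WedgeRel P Q) (Sum.inr Q.pt) := Quot.sound WedgeRel.glue
      rw [h]
      exact (PathConnectedSpace.joined b Q.pt).map
        (f := fun s => Quot.mk (WedgeRel P Q) (Sum.inr s)) (hmk.comp continuous_inr)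
  exact ⟨⟨(wedge P Q).pt⟩, fun p q => (hp p).trans (hp q).symm⟩

end PathConnected

section Contractible

lemma Suspension.contractibleSpace (X : Type) [TopologicalSpace X] [ContractibleSpace X] :
    ContractibleSpace (Suspension X) := by
  obtain ⟨e⟩ := MappingCone.nonempty_equiv_of_contractible_source (ContinuousMap.const X ())
  exact (e.trans (MappingCone.constUnitHomeo X).toHomotopyEquiv).symm.contractibleSpace

lemma iteratedSuspension_contractibleSpace (X : TopCat.{0}) [ContractibleSpace X] (k : ℕ) :
    ContractibleSpace (iteratedSuspension X k) := by
  induction k with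
  | zero => assumption
  | succ k ih => exact Suspension.contractibleSpace _

end Contractible

section Wedge

/-- A homeomorphism of the second summands that preserves base points induces one of wedges. -/
def wedgeCongrRight (P : PointedSpace) {Q R : PointedSpace} (e : Q.space ≃ₜ R.space)
    (he : e Q.pt = R.pt) : (wedge P Q).space ≃ₜ (wedge P R).space where
  toFun := Quot.lift (Sum.elim (fun a => Quot.mk _ (Sum.inl a)) fun b => Quot.mk _ (Sum.inr (e b)))
    (by
      rintro _ _ ⟨⟩
      exact (Quot.sound WedgeRel.glue).trans
        (congrArg (fun z => Quot.mk (WedgeRel P R) (Sum.inr z)) he.symm))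
  invFun := Quot.lift
    (Sum.elim (fun a => Quot.mk _ (Sum.inl a)) fun b => Quot.mk _ (Sum.inr (e.symm b)))
    (by
      rintro _ _ ⟨⟩
      exact (Quot.sound WedgeRel.glue).trans (congrArg (fun z => Quot.mk (WedgeRel P Q) (Sum.inr z))
        (e.symm_apply_eq.mpr he.symm).symm))
  left_inv := by
    rintro ⟨a | b⟩
    · rfl
    · exact congrArg (fun z => Quot.mk (WedgeRel P Q) (Sum.inr z)) (e.symm_apply_apply b)
  right_inv := by
    rintro ⟨a | b⟩
    · rfl
    · exact congrArg (fun z => Quot.mk (WedgeRel P R) (Sum.inr z)) (e.apply_symm_apply b)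
  continuous_toFun := continuous_quot_lift _ (Continuous.sumElim
    (continuous_quot_mk.comp continuous_inl)
    (continuous_quot_mk.comp (continuous_inr.comp e.continuous)))
  continuous_invFun := continuous_quot_lift _ (Continuous.sumElim
    (continuous_quot_mk.comp continuous_inl)
    (continuous_quot_mk.comp (continuous_inr.comp e.symm.continuous)))

end Wedge

/-! ### Spheres -/

section Sphere

lemma mem_unitSphere_iff {n : ℕ} (y : EuclideanSpace ℝ (Fin n)) :
    y ∈ Metric.sphere (0 : EuclideanSpace ℝ (Fin n)) 1 ↔ ∑ i, y i ^ 2 = 1 := by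
  rw [mem_sphere_zero_iff_norm, EuclideanSpace.norm_eq, Real.sqrt_eq_one]
  simp

/-- The map `(x, t) ↦ (1 - 2t, 2√(t(1-t)) x)` that parametrizes `S^{d+1}` by `S^d × [0,1]`. -/
noncomputable def sphereCylinder (d : ℕ) (p : (pointedSphere d).space × unitInterval) :
    (pointedSphere (d + 1)).space :=
  ⟨WithLp.toLp 2 (Fin.cons (1 - 2 * (p.2 : ℝ))
    fun i => 2 * √((p.2 : ℝ) * (1 - p.2)) * p.1.1 i), by
    rw [mem_unitSphere_iff, Fin.sum_univ_succ]
    have hx := (mem_unitSphere_iff _).1 p.1.2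
    have h0 : 0 ≤ (p.2 : ℝ) * (1 - p.2) := mul_nonneg p.2.2.1 (by linarith [p.2.2.2])
    simp only [Fin.cons_zero, Fin.cons_succ, mul_pow, ← Finset.mul_sum, hx, Real.sq_sqrt h0]
    ring⟩

lemma sphereCylinder_continuous (d : ℕ) : Continuous (sphereCylinder d) := by
  refine Continuous.subtype_mk ((PiLp.continuous_toLp 2 _).comp (continuous_pi fun i => ?_)) _
  refine Fin.cases ?_ (fun i => ?_) i
  · simp only [Fin.cons_zero]
    fun_prop
  · simp only [Fin.cons_succ]
    have h : Continuous fun p : (pointedSphere d).space × unitInterval => p.1.1 i :=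
      ((EuclideanSpace.proj (𝕜 := ℝ) i).continuous.comp continuous_subtype_val).comp continuous_fst
    fun_prop

/-- The poles of the sphere. -/
noncomputable def spherePole (d : ℕ) (b : Bool) : (pointedSphere d).space :=
  ⟨EuclideanSpace.single 0 (if b then -1 else 1), by cases b <;> simp⟩

lemma sphere_ext {d : ℕ} {x y : (pointedSphere d).space} (h : ∀ i, x.1 i = y.1 i) : x = y :=
  Subtype.ext (PiLp.ext h)

/-- The comparison map from the suspension of `S^d` to `S^{d+1}`. -/
noncomputable def suspensionSphereMap (d : ℕ) :
    Suspension (pointedSphere d).space → (pointedSphere (d + 1)).space :=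
  Quot.lift (Sum.elim (sphereCylinder d) (spherePole (d + 1))) (by
    rintro _ _ (⟨x⟩ | ⟨x⟩)
    · refine sphere_ext fun i => ?_
      refine Fin.cases ?_ (fun i => ?_) i <;> simp [sphereCylinder, spherePole]
    · refine sphere_ext fun i => ?_
      refine Fin.cases ?_ (fun i => ?_) i <;> simp [sphereCylinder, spherePole]
      norm_num)

lemma suspensionSphereMap_continuous (d : ℕ) : Continuous (suspensionSphereMap d) :=
  continuous_quot_lift _ ((sphereCylinder_continuous d).sumElim continuous_of_discreteTopology)

lemma sphereCylinder_zero (d : ℕ) (p) : (sphereCylinder d p).1 0 = 1 - 2 * (p.2 : ℝ) := rfl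

lemma sphereCylinder_succ (d : ℕ) (p) (i : Fin (d + 1)) :
    (sphereCylinder d p).1 i.succ = 2 * √((p.2 : ℝ) * (1 - p.2)) * p.1.1 i := rfl

/-- Every point of a suspension is a pole or an interior point of a line of the suspension. -/
lemma Suspension.cases {X : Type} (p : Suspension X) :
    (∃ b, p = Quot.mk _ (Sum.inr b)) ∨
      ∃ (x : X) (t : unitInterval), 0 < (t : ℝ) ∧ (t : ℝ) < 1 ∧ p = Quot.mk _ (Sum.inl (x, t)) := by
  obtain ⟨⟨x, t⟩ | b⟩ := p
  · rcases t.2.1.eq_or_lt with h | h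
    · exact Or.inl ⟨false, by rw [show t = 0 from Subtype.ext h.symm]; exact Quot.sound (.bot x)⟩
    · rcases t.2.2.eq_or_lt with h' | h'
      · exact Or.inl ⟨true, by rw [show t = 1 from Subtype.ext h']; exact Quot.sound (.top x)⟩
      · exact Or.inr ⟨x, t, h, h', rfl⟩
  · exact Or.inl ⟨b, rfl⟩

/-- The coordinate `1 - 2t` recovers the height and separates the poles from the rest; at interior
heights the positive factor of the other coordinates cancels. -/
lemma suspensionSphereMap_injective (d : ℕ) : Function.Injective (suspensionSphereMap d) := by
  have hpole : ∀ b, (spherePole (d + 1) b).1 0 = if b then -1 else 1 := fun b => by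
    simp [spherePole]
  intro p q h
  rcases Suspension.cases p with ⟨b, rfl⟩ | ⟨x, t, t0, t1, rfl⟩ <;>
    rcases Suspension.cases q with ⟨c, rfl⟩ | ⟨y, s, s0, s1, rfl⟩
  · change spherePole _ _ = spherePole _ _ at h
    have := congrArg (fun z => z.1 0) h
    simp only [hpole] at this
    cases b <;> cases c <;> first | rfl | (exfalso; norm_num at this)
  · change spherePole _ _ = sphereCylinder _ _ at h
    have := congrArg (fun z => z.1 0) h
    simp only [hpole, sphereCylinder_zero] at this
    cases b <;> simp only [Bool.false_eq_true, reduceIte] at this <;> linarith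
  · change sphereCylinder _ _ = spherePole _ _ at h
    have := congrArg (fun z => z.1 0) h
    simp only [hpole, sphereCylinder_zero] at this
    cases c <;> simp only [Bool.false_eq_true, reduceIte] at this <;> linarith
  · change sphereCylinder _ _ = sphereCylinder _ _ at h
    have h0 := congrArg (fun z => z.1 0) h
    simp only [sphereCylinder_zero] at h0
    obtain rfl : t = s := Subtype.ext (by linarith)
    have hpos : 0 < √((t : ℝ) * (1 - t)) := Real.sqrt_pos.2 (mul_pos t0 (by linarith))
    have : x = y := sphere_ext fun i => by
      have := congrArg (fun z => z.1 i.succ) h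
      simp only [sphereCylinder_succ] at this
      exact mul_left_cancel₀ (by positivity) this
    rw [this]

lemma suspensionSphereMap_surjective (d : ℕ) : Function.Surjective (suspensionSphereMap d) := by
  intro y
  have hy := (mem_unitSphere_iff _).1 y.2
  rw [Fin.sum_univ_succ] at hy
  set c := y.1 0 with hc
  set r := ∑ i : Fin (d + 1), y.1 i.succ ^ 2 with hr
  have hr0 : 0 ≤ r := Finset.sum_nonneg fun i _ => sq_nonneg _
  rcases hr0.eq_or_lt with h | h
  · have hz : ∀ i : Fin (d + 1), y.1 i.succ = 0 := fun i => by
      have := (Finset.sum_eq_zero_iff_of_nonneg (fun i _ => sq_nonneg (y.1 (Fin.succ i)))).1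
        (hr.symm.trans h.symm) i (Finset.mem_univ i)
      exact pow_eq_zero_iff (two_ne_zero) |>.1 this
    have hc2 : c = 1 ∨ c = -1 := sq_eq_one_iff.1 (by linarith)
    rcases hc2 with h1 | h1
    · refine ⟨Quot.mk _ (Sum.inr false), sphere_ext fun i => ?_⟩
      change (spherePole _ _).1 i = _
      refine Fin.cases ?_ (fun i => ?_) i
      · simp [spherePole, ← hc, h1]
      · simp [spherePole, hz]
    · refine ⟨Quot.mk _ (Sum.inr true), sphere_ext fun i => ?_⟩
      change (spherePole _ _).1 i = _
      refine Fin.cases ?_ (fun i => ?_) i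
      · simp [spherePole, ← hc, h1]
      · simp [spherePole, hz]
  · have hs : 0 < √r := Real.sqrt_pos.2 h
    have hc1 : c ≤ 1 := by nlinarith
    have hc2 : -1 ≤ c := by nlinarith
    refine ⟨Quot.mk _ (Sum.inl (⟨WithLp.toLp 2 fun i => y.1 i.succ / √r, ?_⟩,
      ⟨(1 - c) / 2, by constructor <;> linarith⟩)), sphere_ext fun i => ?_⟩
    · rw [mem_unitSphere_iff]
      simp only [div_pow, ← Finset.sum_div, Real.sq_sqrt hr0]
      exact div_self h.ne'
    · change (sphereCylinder _ _).1 i = _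
      refine Fin.cases ?_ (fun i => ?_) i
      · rw [sphereCylinder_zero, ← hc]
        ring
      · rw [sphereCylinder_succ]
        -- With `t = (1 - c) / 2`, the product `t (1 - t)` is `(1 - c²) / 4`, and `1 - c² = r` on
        -- the sphere.
        have e : (1 - c) / 2 * (1 - (1 - c) / 2) = r / 2 ^ 2 := by linarith
        simp only [e]
        rw [Real.sqrt_div hr0, Real.sqrt_sq (by norm_num)]
        field_simp

instance (X : Type) [TopologicalSpace X] [CompactSpace X] : CompactSpace (Suspension X) :=
  inferInstanceAs (CompactSpace (Quot _))

instance (d : ℕ) : CompactSpace (pointedSphere d).space :=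
  isCompact_iff_compactSpace.1 (isCompact_sphere _ _)

instance (d : ℕ) : T2Space (pointedSphere d).space :=
  inferInstanceAs (T2Space (Metric.sphere (0 : EuclideanSpace ℝ (Fin (d + 1))) 1))

/-- The suspension of `S^d` is `S^{d+1}`. -/
noncomputable def suspensionSphereHomeo (d : ℕ) :
    (suspensionPointed (pointedSphere d).space).space ≃ₜ (pointedSphere (d + 1)).space :=
  Continuous.homeoOfEquivCompactToT2
    (X := Suspension (pointedSphere d).space)
    (f := Equiv.ofBijective (suspensionSphereMap d)
      ⟨suspensionSphereMap_injective d, suspensionSphereMap_surjective d⟩)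
    (suspensionSphereMap_continuous d)

lemma suspensionSphereHomeo_pt (d : ℕ) :
    suspensionSphereHomeo d (suspensionPointed (pointedSphere d).space).pt =
      (pointedSphere (d + 1)).pt := by
  change spherePole _ _ = _
  exact Subtype.ext (by simp [spherePole, pointedSphere])

/-- The suspension of the empty space is `S^0`. -/
noncomputable def suspensionEmptyHomeo (X : Type) [TopologicalSpace X] [IsEmpty X] :
    Suspension X ≃ₜ (pointedSphere 0).space :=
  Continuous.homeoOfEquivCompactToT2
    (X := Suspension X)
    (f := Equiv.ofBijective (Quot.lift (Sum.elim (fun p => isEmptyElim p.1) (spherePole 0))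
      (by rintro _ _ (⟨x⟩ | ⟨x⟩) <;> exact isEmptyElim x)) (by
      constructor
      · rintro ⟨⟨x, t⟩ | b⟩ ⟨⟨y, s⟩ | c⟩ h
        · exact isEmptyElim x
        · exact isEmptyElim x
        · exact isEmptyElim y
        · change spherePole _ _ = spherePole _ _ at h
          have := congrArg (fun z => z.1 0) h
          cases b <;> cases c <;> first | rfl | (exfalso; norm_num [spherePole] at this)
      · intro y
        have hy := (mem_unitSphere_iff _).1 y.2
        rw [Fin.sum_univ_one, sq_eq_one_iff] at hy
        rcases hy with h | h
        · refine ⟨Quot.mk _ (Sum.inr false), sphere_ext fun i => ?_⟩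
          change (spherePole _ _).1 i = _
          rw [show i = 0 from Fin.fin_one_eq_zero i]
          simp [spherePole, h]
        · refine ⟨Quot.mk _ (Sum.inr true), sphere_ext fun i => ?_⟩
          change (spherePole _ _).1 i = _
          rw [show i = 0 from Fin.fin_one_eq_zero i]
          simp [spherePole, h]))
    (continuous_quot_lift _ (Continuous.sumElim (continuous_of_const fun p => isEmptyElim p.1)
      continuous_of_discreteTopology))

/-- The iterated suspensions of the empty space are spheres. -/
lemma iteratedSuspension_empty (X : TopCat.{0}) [IsEmpty X] (d : ℕ) :
    Nonempty (iteratedSuspension X (d + 1) ≃ₕ (pointedSphere d).space) := by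
  induction d with
  | zero => exact ⟨(suspensionEmptyHomeo X).toHomotopyEquiv⟩
  | succ d ih =>
    obtain ⟨e⟩ := ih
    obtain ⟨e'⟩ := Suspension.nonempty_congr e
    exact ⟨e'.trans (suspensionSphereHomeo d).toHomotopyEquiv⟩

lemma pointedSphere_pathConnectedSpace (d : ℕ) : PathConnectedSpace (pointedSphere (d + 1)).space :=
  isPathConnected_iff_pathConnectedSpace.1 (isPathConnected_sphere
    (by rw [← Module.finrank_eq_rank]; simp; norm_cast; omega) _ zero_le_one)

end Sphere

/-! ### Independence complexes of induced subgraphs -/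

section IndReal

variable {V : Type}

/-- The realization of the independence complex of the subgraph of `G` induced on `S`, as a set of
functions on all vertices of `G`. -/
def indReal (G : SimpleGraph V) (S : Finset V) : Set (V → ℝ) :=
  -- Vanishing of the products along edges says that the support is independent, and is visibly a
  -- closed condition.
  {x | (∀ v, 0 ≤ x v) ∧ (∀ v ∉ S, x v = 0) ∧ ∑ v ∈ S, x v = 1 ∧ ∀ u v, G.Adj u v → x u * x v = 0}

variable {G : SimpleGraph V} {S T A L : Finset V}

lemma indReal_mono (h : S ⊆ T) : indReal G S ⊆ indReal G T := by
  rintro x ⟨h0, h1, h2, h3⟩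
  refine ⟨h0, fun v hv => h1 v fun hS => hv (h hS), ?_, h3⟩
  rw [← h2]
  exact (Finset.sum_subset h fun v _ hv => h1 v hv).symm

lemma link_subset_deletion {v : V} (hA : ∀ w, w ∈ A ↔ w ∈ S ∧ w ≠ v)
    (hL : ∀ w, w ∈ L ↔ w ∈ S ∧ w ≠ v ∧ ¬ G.Adj v w) : L ⊆ A :=
  fun w hw => (hA w).2 ⟨((hL w).1 hw).1, ((hL w).1 hw).2.1⟩

lemma deletion_subset {v : V} (hA : ∀ w, w ∈ A ↔ w ∈ S ∧ w ≠ v) : A ⊆ S := fun w hw => ((hA w).1 hw).1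

variable [DecidableEq V]

lemma indReal_le_one {x : V → ℝ} (hx : x ∈ indReal G S) (v : V) : x v ≤ 1 := by
  by_cases hv : v ∈ S
  · rw [← hx.2.2.1]
    exact Finset.single_le_sum (fun w _ => hx.1 w) hv
  · rw [hx.2.1 v hv]
    exact zero_le_one

/-- `V` may be infinite, so compactness comes from Tychonoff's theorem for the cube. -/
lemma isCompact_indReal (G : SimpleGraph V) (S : Finset V) : IsCompact (indReal G S) := by
  refine IsCompact.of_isClosed_subset (isCompact_univ_pi fun _ : V => isCompact_Icc (a := (0 : ℝ)) (b := 1)) ?_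
    fun x hx v _ => ⟨hx.1 v, indReal_le_one hx v⟩
  simp only [indReal, Set.ofPred_and, Set.ofPred_forall]
  refine IsClosed.inter ?_ (IsClosed.inter ?_ (IsClosed.inter ?_ ?_))
  · exact isClosed_iInter fun v => isClosed_le continuous_const (continuous_apply v)
  · exact isClosed_iInter fun v => isClosed_iInter fun _ =>
      isClosed_eq (continuous_apply v) continuous_const
  · exact isClosed_eq (continuous_finsetSum _ fun v _ => continuous_apply v) continuous_const
  · exact isClosed_iInter fun u => isClosed_iInter fun v => isClosed_iInter fun _ =>
      isClosed_eq ((continuous_apply u).mul (continuous_apply v)) continuous_const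

instance (G : SimpleGraph V) (S : Finset V) : CompactSpace (indReal G S) :=
  isCompact_iff_compactSpace.1 (isCompact_indReal G S)

instance (G : SimpleGraph V) : IsEmpty (indReal G ∅) :=
  ⟨fun x => by simpa using x.2.2.2.1⟩

/-- The inclusion of the realizations for an inclusion of vertex sets. -/
def indIncl (G : SimpleGraph V) (h : S ⊆ T) : C(indReal G S, indReal G T) :=
  ⟨Set.inclusion (indReal_mono h), continuous_inclusion _⟩

/-- The vertex `v` of an independence complex, as a function on the vertices of the graph. -/
def vertexPoint (v : V) : V → ℝ := Pi.single v 1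

@[simp] lemma vertexPoint_self (v : V) : vertexPoint v v = 1 := Pi.single_eq_same _ _

lemma vertexPoint_of_ne {v w : V} (h : w ≠ v) : vertexPoint v w = 0 := Pi.single_eq_of_ne h _

lemma vertexPoint_mem_indReal {v : V} (hv : v ∈ S) : vertexPoint v ∈ indReal G S := by
  refine ⟨fun w => ?_, fun w hw => vertexPoint_of_ne fun h => hw (by rwa [h]), ?_, fun u w h => ?_⟩
  · by_cases h : w = v
    · simp [h]
    · simp [vertexPoint_of_ne h]
  · simp [vertexPoint, hv]
  · by_cases h' : u = v
    · subst h'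
      rw [vertexPoint_of_ne h.ne', mul_zero]
    · rw [vertexPoint_of_ne h', zero_mul]

/-- The segment from a point that vanishes on the neighbors of `v` to the vertex `v`. -/
lemma segment_mem_indReal {v : V} (hv : v ∈ S) {x : V → ℝ} (hx : x ∈ indReal G S)
    (hsv : ∀ w, G.Adj v w → x w = 0) (t : unitInterval) :
    (fun w => (1 - (t : ℝ)) * x w + t * vertexPoint v w) ∈ indReal G S := by
  have hs := vertexPoint_mem_indReal (G := G) hv
  have h1t : 0 ≤ 1 - (t : ℝ) := by linarith [t.2.2]
  have hsn : ∀ w, w ≠ v → vertexPoint v w = 0 := fun w hw => Pi.single_eq_of_ne hw _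
  refine ⟨fun w => add_nonneg (mul_nonneg h1t (hx.1 w)) (mul_nonneg t.2.1 (hs.1 w)),
    fun w hw => ?_, ?_, fun u w h => ?_⟩
  · simp only [hx.2.1 w hw, hs.2.1 w hw]; ring
  · rw [Finset.sum_add_distrib, ← Finset.mul_sum, ← Finset.mul_sum, hx.2.2.1, hs.2.2.1]; ring
  · by_cases hu : u = v
    · subst hu
      simp only [hsv w h, hsn w h.ne']
      ring
    · by_cases hw : w = v
      · subst hw
        simp only [hsv u h.symm, hsn u hu]
        ring
      · simp only [hsn u hu, hsn w hw]
        linear_combination (1 - (t : ℝ)) ^ 2 * hx.2.2.2 u w h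

section Cone

variable {v : V} (hv : v ∈ S) (hA : ∀ w, w ∈ A ↔ w ∈ S ∧ w ≠ v)
  (hL : ∀ w, w ∈ L ↔ w ∈ S ∧ w ≠ v ∧ ¬ G.Adj v w)

/-- The comparison map from the mapping cone of the inclusion of the link of a vertex. -/
noncomputable def indConeMap : C(MappingCone (indIncl G (link_subset_deletion hA hL)), indReal G S) where
  toFun := Quot.lift (Sum.elim (fun p => ⟨_, segment_mem_indReal hv (indReal_mono (fun w hw => ((hL w).1 hw).1) p.1.2)
      (fun w hw => p.1.2.2.1 w fun h => ((hL w).1 h).2.2 hw) p.2⟩)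
    (Sum.elim (indIncl G (deletion_subset hA)) fun _ => ⟨_, vertexPoint_mem_indReal hv⟩)) (by
    rintro _ _ (⟨x⟩ | ⟨x⟩)
    · exact Subtype.ext (funext fun w => by simp [indIncl])
    · exact Subtype.ext (funext fun w => by simp))
  continuous_toFun := continuous_quot_lift _ (by
    refine Continuous.sumElim (Continuous.subtype_mk (continuous_pi fun w => ?_) _)
      (Continuous.sumElim (map_continuous _) continuous_const)
    have : Continuous fun p : indReal G L × unitInterval => p.1.1 w :=
      (continuous_apply w).comp (continuous_subtype_val.comp continuous_fst)
    fun_prop)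

lemma MappingCone.cases {X Y : Type} [TopologicalSpace X] [TopologicalSpace Y] {f : C(X, Y)}
    (p : MappingCone f) : (∃ a, p = Quot.mk _ (Sum.inr (Sum.inl a))) ∨
      (∃ (x : X) (t : unitInterval), 0 < (t : ℝ) ∧ (t : ℝ) < 1 ∧ p = Quot.mk _ (Sum.inl (x, t))) ∨
      p = Quot.mk _ (Sum.inr (Sum.inr ())) := by
  obtain ⟨⟨x, t⟩ | a | b⟩ := p
  · rcases t.2.1.eq_or_lt with h | h
    · exact Or.inl ⟨f x, by rw [show t = 0 from Subtype.ext h.symm]; exact Quot.sound (.base x)⟩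
    · rcases t.2.2.eq_or_lt with h' | h'
      · exact Or.inr (Or.inr
          (by rw [show t = 1 from Subtype.ext h']; exact Quot.sound (.tip x)))
      · exact Or.inr (Or.inl ⟨x, t, h, h', rfl⟩)
  · exact Or.inl ⟨a, rfl⟩
  · exact Or.inr (Or.inr rfl)

/-- The coordinate at `v` is the cone parameter: 0 on the base, `t` on the cone, 1 at the tip. -/
lemma indConeMap_injective : Function.Injective (indConeMap hv hA hL) := by
  have hAv : ∀ a : indReal G A, a.1 v = 0 := fun a => a.2.2.1 v fun h => ((hA v).1 h).2 rfl
  have hLv : ∀ x : indReal G L, x.1 v = 0 := fun x => x.2.2.1 v fun h => ((hL v).1 h).2.1 rfl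
  have ev : ∀ p q, indConeMap hv hA hL p = indConeMap hv hA hL q → ∀ w,
      (indConeMap hv hA hL p).1 w = (indConeMap hv hA hL q).1 w := fun p q h w => by rw [h]
  have e1 : ∀ a w, (indConeMap hv hA hL (Quot.mk _ (Sum.inr (Sum.inl a)))).1 w = a.1 w :=
    fun a w => rfl
  have e2 : ∀ x t w, (indConeMap hv hA hL (Quot.mk _ (Sum.inl (x, t)))).1 w =
    (1 - (t : ℝ)) * x.1 w + t * vertexPoint v w := fun x t w => rfl
  have e3 : ∀ w, (indConeMap hv hA hL (Quot.mk _ (Sum.inr (Sum.inr ())))).1 w =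
    vertexPoint v w := fun w => rfl
  intro p q h
  have hw := ev p q h
  have hvv := hw v
  rcases MappingCone.cases p with ⟨a, rfl⟩ | ⟨x, t, t0, t1, rfl⟩ | rfl <;>
    rcases MappingCone.cases q with ⟨b, rfl⟩ | ⟨y, s, s0, s1, rfl⟩ | rfl <;>
    simp only [e1, e2, e3, hAv, hLv, vertexPoint_self] at hvv hw
  · rw [Subtype.ext (funext hw)]
  · exfalso; linarith
  · exfalso; linarith
  · exfalso; linarith
  · obtain rfl : t = s := Subtype.ext (by linarith)
    have : x = y := Subtype.ext (funext fun w => by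
      have := hw w
      have h1t : (1 - (t : ℝ)) ≠ 0 := by linarith
      exact mul_left_cancel₀ h1t (by linarith))
    rw [this]
  · exfalso; linarith
  · exfalso; linarith
  · exfalso; linarith
  · rfl

lemma indConeMap_surjective : Function.Surjective (indConeMap hv hA hL) := by
  rintro ⟨x, hx⟩
  have hsum : x v + ∑ w ∈ A, x w = 1 := by
    have hAe : A = S.erase v := Finset.ext fun w => by rw [hA, Finset.mem_erase]; tauto
    rw [hAe, Finset.add_sum_erase _ _ hv, hx.2.2.1]
  rcases (hx.1 v).eq_or_lt with h0 | h0
  · refine ⟨Quot.mk _ (Sum.inr (Sum.inl ⟨x, hx.1, fun w hw => ?_, by linarith, hx.2.2.2⟩)), rfl⟩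
    by_cases h : w = v
    · rw [h, ← h0]
    · exact hx.2.1 w fun hS => hw ((hA w).2 ⟨hS, h⟩)
  · have hadj : ∀ w, G.Adj v w → x w = 0 := fun w hw =>
      (mul_eq_zero.1 (hx.2.2.2 v w hw)).resolve_left h0.ne'
    rcases (indReal_le_one hx v).eq_or_lt with h1 | h1
    · refine ⟨Quot.mk _ (Sum.inr (Sum.inr ())), Subtype.ext (funext fun w => ?_)⟩
      change vertexPoint v w = x w
      by_cases h : w = v
      · subst h; simp [h1]
      · rw [vertexPoint_of_ne h]
        by_cases hwS : w ∈ S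
        · have h2 : ∑ w ∈ A, x w = 0 := by linarith
          exact ((Finset.sum_eq_zero_iff_of_nonneg fun w _ => hx.1 w).1 h2 w
            ((hA w).2 ⟨hwS, h⟩)).symm
        · exact (hx.2.1 w hwS).symm
    · have hpos : 0 < 1 - x v := by linarith
      -- Projection away from the vertex `v` onto the opposite face. Since `x v > 0`, the support of
      -- `x` avoids the neighbors of `v`, so `y` lies in the link.
      let y : V → ℝ := fun w => if w = v then 0 else x w / (1 - x v)
      have hyL : ∀ w ∉ L, y w = 0 := fun w hw => by
        by_cases h : w = v
        · simp [y, h]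
        · have : x w = 0 := by
            by_cases hwS : w ∈ S
            · refine hadj w ?_
              by_contra hn
              exact hw ((hL w).2 ⟨hwS, h, hn⟩)
            · exact hx.2.1 w hwS
          simp [y, h, this]
      have hyA : ∀ w ∈ A, y w = x w / (1 - x v) := fun w hw => by
        simp [y, ((hA w).1 hw).2]
      have hy : y ∈ indReal G L := by
        refine ⟨fun w => ?_, hyL, ?_, fun u w h => ?_⟩
        · by_cases h : w = v
          · simp [y, h]
          · simp only [y, h, if_false]
            exact div_nonneg (hx.1 w) hpos.le
        · rw [Finset.sum_subset (link_subset_deletion hA hL) fun w _ hw => hyL w hw,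
            Finset.sum_congr rfl hyA, ← Finset.sum_div, div_eq_one_iff_eq hpos.ne']
          linarith
        · by_cases hu : u = v
          · simp [y, hu]
          · by_cases hw : w = v
            · simp [y, hw]
            · simp only [y, hu, hw, if_false]
              rw [div_mul_div_comm, hx.2.2.2 u w h, zero_div]
      refine ⟨Quot.mk _ (Sum.inl (⟨y, hy⟩, ⟨x v, hx.1 v, h1.le⟩)), Subtype.ext (funext fun w => ?_)⟩
      change (1 - x v) * y w + x v * vertexPoint v w = x w
      by_cases h : w = v
      · subst h; simp [y]
      · simp only [y, h, if_false, vertexPoint_of_ne h]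
        field_simp
        ring

instance {X Y : Type} [TopologicalSpace X] [TopologicalSpace Y] [CompactSpace X] [CompactSpace Y]
    (f : C(X, Y)) : CompactSpace (MappingCone f) :=
  inferInstanceAs (CompactSpace (Quot _))

/-- An independence complex is the mapping cone of the inclusion of the link of a vertex into the
deletion of the vertex. -/
noncomputable def indConeHomeo :
    MappingCone (indIncl G (link_subset_deletion hA hL)) ≃ₜ indReal G S :=
  Continuous.homeoOfEquivCompactToT2
    (f := Equiv.ofBijective (indConeMap hv hA hL)
      ⟨indConeMap_injective hv hA hL, indConeMap_surjective hv hA hL⟩)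
    (indConeMap hv hA hL).continuous

end Cone

/-- A vertex whose link is contractible can be deleted. -/
lemma indReal_deletion {v : V} (hv : v ∈ S) (hA : ∀ w, w ∈ A ↔ w ∈ S ∧ w ≠ v)
    (hL : ∀ w, w ∈ L ↔ w ∈ S ∧ w ≠ v ∧ ¬ G.Adj v w) (h : ContractibleSpace (indReal G L)) :
    Nonempty (indReal G S ≃ₕ indReal G A) := by
  obtain ⟨e⟩ := MappingCone.nonempty_equiv_of_contractible_source
    (indIncl G (link_subset_deletion hA hL))
  exact ⟨(e.trans (indConeHomeo hv hA hL).toHomotopyEquiv).symm⟩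

/-- If the deletion of a vertex is contractible, then the complex is the suspension of the link. -/
lemma indReal_suspension {v : V} (hv : v ∈ S) (hA : ∀ w, w ∈ A ↔ w ∈ S ∧ w ≠ v)
    (hL : ∀ w, w ∈ L ↔ w ∈ S ∧ w ≠ v ∧ ¬ G.Adj v w) (h : ContractibleSpace (indReal G A)) :
    Nonempty (indReal G S ≃ₕ Suspension (indReal G L)) := by
  obtain ⟨e⟩ := MappingCone.nonempty_equiv_suspension (indIncl G (link_subset_deletion hA hL))
  exact ⟨(indConeHomeo hv hA hL).symm.toHomotopyEquiv.trans e⟩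

/-- If the inclusion of the link of a vertex into its deletion factors through a contractible
induced subcomplex, then the complex splits as a wedge. -/
lemma indReal_wedge {v : V} {W : Finset V} (hv : v ∈ S) (hA : ∀ w, w ∈ A ↔ w ∈ S ∧ w ≠ v)
    (hL : ∀ w, w ∈ L ↔ w ∈ S ∧ w ≠ v ∧ ¬ G.Adj v w) (hLW : L ⊆ W) (hWA : W ⊆ A)
    (h : ContractibleSpace (indReal G W)) {P : PointedSpace} [PathConnectedSpace P.space]
    {M : Type} [TopologicalSpace M] (eA : indReal G A ≃ₕ P.space) (eL : indReal G L ≃ₕ M) :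
    Nonempty (indReal G S ≃ₕ (wedge P (suspensionPointed M)).space) := by
  have hn : (indIncl G (link_subset_deletion hA hL)).Nullhomotopic :=
    (ContinuousMap.Nullhomotopic.comp_right (id_nullhomotopic (indReal G W))
      (indIncl G hWA)).comp_left (indIncl G hLW)
  obtain ⟨e⟩ := MappingCone.nonempty_equiv_wedge hn eA eL
  exact ⟨(indConeHomeo hv hA hL).symm.toHomotopyEquiv.trans e⟩

/-- The independence complex is contractible if there is an isolated vertex. -/
lemma indReal_contractibleSpace {v : V} (hv : v ∈ S) (h : ∀ w ∈ S, ¬ G.Adj v w) :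
    ContractibleSpace (indReal G S) := by
  have hmem := fun x : indReal G S =>
    segment_mem_indReal hv x.2 fun w hw => x.2.2.1 w fun hS => h w hS hw
  rw [contractible_iff_id_nullhomotopic]
  refine ⟨⟨_, vertexPoint_mem_indReal hv⟩, ⟨⟨⟨fun p => ⟨_, hmem p.2 p.1⟩, ?_⟩, fun x => ?_, fun x => ?_⟩⟩⟩
  · refine Continuous.subtype_mk (continuous_pi fun w => ?_) _
    have : Continuous fun p : unitInterval × indReal G S => p.2.1 w :=
      (continuous_apply w).comp (continuous_subtype_val.comp continuous_snd)
    fun_prop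
  · exact Subtype.ext (funext fun w => by simp)
  · exact Subtype.ext (funext fun w => by simp)

end IndReal

/-! ### From `IndSpace` to realizations inside a larger graph -/

section Transfer

variable {V W : Type} [Fintype W] [DecidableEq V]

/-- The space `Ind(H)` is the realization of an induced subgraph isomorphic to `H`. -/
noncomputable def indSpaceHomeo (H : SimpleGraph W) (G : SimpleGraph V) (S : Finset V) (e : W → V)
    (he : Function.Injective e) (hS : ∀ v, v ∈ S ↔ ∃ w, e w = v)
    (hadj : ∀ u w, H.Adj u w ↔ G.Adj (e u) (e w)) : IndSpace H ≃ₜ indReal G S := by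
  classical
  have hsum : ∀ x : V → ℝ, ∑ v ∈ S, x v = ∑ w, x (e w) := fun x => by
    have : S = Finset.univ.map ⟨e, he⟩ := Finset.ext fun v => by simp [hS]
    rw [this, Finset.sum_map]
    rfl
  have hext : ∀ (x : W → ℝ) w, Function.extend e x 0 (e w) = x w := fun x w =>
    he.extend_apply x 0 w
  -- The face demanded by `geomRealization` can be taken to be the support, which is independent
  -- exactly when the products along edges vanish.
  have hind : ∀ x : W → ℝ, x ∈ stdSimplex ℝ W → (x ∈ geomRealization (indComplex H) ↔
      ∀ u w, H.Adj u w → x u * x w = 0) := by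
    intro x hx
    constructor
    · rintro ⟨-, s, hs, hxs⟩ u w huw
      by_contra hne
      have := mul_ne_zero_iff.1 hne
      exact hs.2 (hxs u this.1) (hxs w this.2) huw.ne huw
    · intro h
      refine ⟨hx, Finset.univ.filter fun w => x w ≠ 0, ⟨?_, ?_⟩, fun w hw => by simpa using hw⟩
      · by_contra hn
        rw [Finset.not_nonempty_iff_eq_empty, Finset.filter_eq_empty_iff] at hn
        have h1 := hx.2
        rw [Finset.sum_eq_zero fun w _ => not_not.1 (hn (Finset.mem_univ w))] at h1
        exact zero_ne_one h1
      · intro u hu w hw _ huw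
        simp only [Finset.coe_filter, Finset.mem_univ, true_and, Set.mem_ofPred_eq] at hu hw
        exact mul_ne_zero hu hw (h u w huw)
  exact
  { toFun := fun x => ⟨Function.extend e x.1 0, by
      have hx := (hind x.1 x.2.1).1 x.2
      have hx1 := x.2.1
      refine ⟨fun v => ?_, fun v hv => ?_, ?_, fun u v h => ?_⟩
      · by_cases hv : ∃ w, e w = v
        · obtain ⟨w, rfl⟩ := hv
          rw [hext]
          exact hx1.1 w
        · rw [Function.extend_apply' _ _ _ hv]
          exact le_rfl
      · exact Function.extend_apply' _ _ _ fun h => hv ((hS v).2 h)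
      · rw [hsum]
        simp only [hext]
        exact hx1.2
      · by_cases hu : ∃ w, e w = u
        · by_cases hv : ∃ w, e w = v
          · obtain ⟨u, rfl⟩ := hu
            obtain ⟨v, rfl⟩ := hv
            rw [hext, hext]
            exact hx u v ((hadj u v).2 h)
          · rw [Function.extend_apply' _ _ _ hv]
            exact mul_zero _
        · rw [Function.extend_apply' _ _ _ hu]
          exact zero_mul _⟩
    invFun := fun x => ⟨fun w => x.1 (e w), by
      refine (hind _ ⟨fun w => x.2.1 _, ?_⟩).2 fun u w h => x.2.2.2.2 _ _ ((hadj u w).1 h)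
      rw [← x.2.2.2.1, hsum]⟩
    left_inv := fun x => Subtype.ext (funext fun w => hext _ w)
    right_inv := fun x => Subtype.ext (funext fun v => by
      by_cases hv : ∃ w, e w = v
      · obtain ⟨w, rfl⟩ := hv
        exact hext _ w
      · exact (Function.extend_apply' _ _ _ hv).trans (x.2.2.1 v fun h => hv ((hS v).1 h)).symm)
    continuous_toFun := by
      refine Continuous.subtype_mk (continuous_pi fun v => ?_) _
      by_cases hv : ∃ w, e w = v
      · obtain ⟨w, rfl⟩ := hv
        simp only [hext]
        exact (continuous_apply w).comp continuous_subtype_val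
      · simp only [Function.extend_apply' _ _ _ hv]
        exact continuous_const
    continuous_invFun := by
      refine Continuous.subtype_mk (continuous_pi fun w => ?_) _
      exact (continuous_apply (e w)).comp continuous_subtype_val }

end Transfer

/-! ### Peeling leaves off the double hexagonal strip -/

/-- The adjacency of the double hexagonal strip on all labels. -/
def hexStrip : SimpleGraph (ℕ × ℕ) := SimpleGraph.fromRel (hexRel 2)

/-- A computable form of `hexRel 2`. -/
def hexStep (p q : ℕ × ℕ) : Bool :=
  (q.1 == p.1 && q.2 == p.2 + 1) ||
  (decide (p.1 < 2) && q.1 == p.1 + 1 && p.2 % 2 == 1 && q.2 == p.2 + 1) ||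
  (p.1 == 2 && q.1 == 3 && p.2 % 2 == 1 && q.2 == p.2)

/-- A computable form of the adjacency of the double hexagonal strip. -/
def hexAdj (p q : ℕ × ℕ) : Bool := hexStep p q || hexStep q p

lemma hexStep_iff (p q : ℕ × ℕ) : hexStep p q = true ↔ hexRel 2 p q := by
  simp [hexStep, hexRel, Nat.odd_iff, and_assoc, or_assoc]

lemma hexStrip_adj_iff (p q : ℕ × ℕ) : hexStrip.Adj p q ↔ hexAdj p q = true := by
  rw [hexStrip, SimpleGraph.fromRel_adj, hexAdj, Bool.or_eq_true, hexStep_iff, hexStep_iff,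
    and_iff_right_iff_imp]
  rintro h rfl
  rcases h with h | h <;> rcases h with h | h | h <;> omega

/-- The list of the neighbors of a vertex of the double hexagonal strip. -/
def hexNeighbors (p : ℕ × ℕ) : List (ℕ × ℕ) :=
  [(p.1, p.2 + 1), (p.1, p.2 - 1), (p.1 + 1, p.2 + 1), (p.1 - 1, p.2 - 1), (p.1 + 1, p.2),
    (p.1 - 1, p.2)].filter (hexAdj p)

/-- The six candidates are all the displacements an edge can realize; spurious ones, also those from
truncated subtraction, are discarded by the filter. -/
lemma mem_hexNeighbors (p q : ℕ × ℕ) : q ∈ hexNeighbors p ↔ hexStrip.Adj p q := by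
  rw [hexNeighbors, List.mem_filter, ← hexStrip_adj_iff, and_iff_right_iff_imp,
    hexStrip, SimpleGraph.fromRel_adj]
  obtain ⟨i, r⟩ := p
  obtain ⟨j, s⟩ := q
  rintro ⟨-, h⟩
  simp only [hexRel, List.mem_cons, Prod.mk.injEq, List.not_mem_nil, or_false] at h ⊢
  rcases h with (h | h | h) | (h | h | h) <;> omega

section Peel

/-- The vertices of `T` that do not occur in the list `D`. -/
def hexRest (T : Finset (ℕ × ℕ)) (D : List (ℕ × ℕ)) : Finset (ℕ × ℕ) := T.filter (· ∉ D)

/-- The space of the independence complex of the strip on the vertices of `T` outside `D`. -/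
def hexSpace (T : Finset (ℕ × ℕ)) (D : List (ℕ × ℕ)) : TopCat.{0} :=
  TopCat.of (indReal hexStrip (hexRest T D))

-- Computable lower and upper bounds for the vertex set `T`. Vertices that a move uses must satisfy
-- `sure`; neighbors that must be absent are ignored only if they are removed or fail `poss`. A
-- successful check is therefore valid for every `T` between the two bounds.
variable (sure poss : ℕ × ℕ → Bool)

/-- Check that the only neighbors of `u` that may remain after removing `D` are those in `l`. -/
def neighborsWithin (D l : List (ℕ × ℕ)) (u : ℕ × ℕ) : Bool :=
  (hexNeighbors u).all fun x => l.contains x || D.contains x || !poss x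

/-- Check that `u` remains after removing `D`. -/
def remains (D : List (ℕ × ℕ)) (u : ℕ × ℕ) : Bool := sure u && !D.contains u

/-- Remove successively the closed neighborhoods of the second components of `ms`; each time the
first component has to be a leaf attached to the second one. -/
def peel : List ((ℕ × ℕ) × (ℕ × ℕ)) → List (ℕ × ℕ) → Option (List (ℕ × ℕ))
  | [], D => some D
  | (u, w) :: ms, D =>
    if remains sure D u && remains sure D w && hexAdj w u && neighborsWithin poss D [w] u then
      peel ms (w :: hexNeighbors w ++ D)
    else none

/-- Check that peeling leads to a remainder with an isolated vertex. -/
def peelsToIsolated (D : List (ℕ × ℕ)) (ms : List ((ℕ × ℕ) × (ℕ × ℕ))) (u : ℕ × ℕ) : Bool :=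
  (peel sure poss ms D).any fun D' => remains sure D' u && neighborsWithin poss D' [] u

/-- Check that peeling removes exactly the first `c i` vertices of row `i`, for each `i`. -/
def peelsToCut (D : List (ℕ × ℕ)) (ms : List ((ℕ × ℕ) × (ℕ × ℕ))) (c : ℕ → ℕ) : Bool :=
  (peel sure poss ms D).any fun D' =>
    (D'.all fun p => !poss p || decide (p.2 ≤ c p.1)) &&
    [1, 2, 3].all fun i => (List.range (c i + 1)).all fun r => D'.contains (i, r) || !poss (i, r)

/-- Check that the link of `v` is contained in the remainder after removing `l`, which does not
contain `v`. -/
def splitsAt (D : List (ℕ × ℕ)) (v : ℕ × ℕ) (l : List (ℕ × ℕ)) : Bool :=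
  remains sure D v && l.all (hexAdj v)

variable {sure poss} {T : Finset (ℕ × ℕ)}

lemma mem_hexRest {D : List (ℕ × ℕ)} {p : ℕ × ℕ} : p ∈ hexRest T D ↔ p ∈ T ∧ p ∉ D := by
  simp [hexRest]

lemma mem_of_remains (hs : ∀ p, sure p = true → p ∈ T) {D : List (ℕ × ℕ)} {u : ℕ × ℕ} (h : remains sure D u = true) :
    u ∈ hexRest T D := by
  simp only [remains, Bool.and_eq_true, Bool.not_eq_true', List.contains_eq_mem,
    decide_eq_false_iff_not] at h
  exact mem_hexRest.2 ⟨hs u h.1, h.2⟩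

lemma mem_of_neighborsWithin
    (hp : ∀ p ∈ T, poss p = true) {D l : List (ℕ × ℕ)} {u x : ℕ × ℕ}
    (h : neighborsWithin poss D l u = true) (hx : x ∈ hexRest T D) (ha : hexStrip.Adj u x) :
    x ∈ l := by
  have := List.all_eq_true.1 h x ((mem_hexNeighbors u x).2 ha)
  have hx' := mem_hexRest.1 hx
  simpa [hx'.2, hp x hx'.1] using this

lemma mem_hexRest_cons {D : List (ℕ × ℕ)} (v w : ℕ × ℕ) :
    w ∈ hexRest T (v :: D) ↔ w ∈ hexRest T D ∧ w ≠ v := by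
  simp only [mem_hexRest, List.mem_cons]
  tauto

lemma mem_hexRest_star {D : List (ℕ × ℕ)} (v w : ℕ × ℕ) :
    w ∈ hexRest T (v :: hexNeighbors v ++ D) ↔
      w ∈ hexRest T D ∧ w ≠ v ∧ ¬ hexStrip.Adj v w := by
  simp only [mem_hexRest, List.cons_append, List.mem_cons, List.mem_append, mem_hexNeighbors]
  tauto

/-- In each move `w` is the only possible remaining neighbor of `u`, so deleting `w` isolates `u`
and the deletion is contractible. The complex is then the suspension of the link of `w`, the
remainder after the closed neighborhood of `w` is removed. -/
lemma hexSpace_peel (hs : ∀ p, sure p = true → p ∈ T)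
    (hp : ∀ p ∈ T, poss p = true) {Y : TopCat.{0}} (ms : List ((ℕ × ℕ) × (ℕ × ℕ))) (D D' : List (ℕ × ℕ))
    (h : peel sure poss ms D = some D') (e : Nonempty (hexSpace T D' ≃ₕ Y)) :
    Nonempty (hexSpace T D ≃ₕ iteratedSuspension Y ms.length) := by
  induction ms generalizing D with
  | nil =>
    obtain rfl : D = D' := Option.some.inj h
    exact e
  | cons m ms ih =>
    obtain ⟨u, w⟩ := m
    rw [peel] at h
    split_ifs at h with hc
    obtain ⟨e'⟩ := ih _ h
    simp only [Bool.and_eq_true] at hc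
    obtain ⟨⟨⟨hu, hw⟩, ha⟩, hn⟩ := hc
    have hadj := (hexStrip_adj_iff w u).2 ha
    have hcon : ContractibleSpace (indReal hexStrip (hexRest T (w :: D))) := by
      refine indReal_contractibleSpace (v := u)
        ((mem_hexRest_cons w u).2 ⟨mem_of_remains hs hu, hadj.ne'⟩) fun x hx hux => ?_
      have hx' := (mem_hexRest_cons w x).1 hx
      exact hx'.2 (List.mem_singleton.1 (mem_of_neighborsWithin hp hn hx'.1 hux))
    obtain ⟨e1⟩ := indReal_suspension (mem_of_remains hs hw) (mem_hexRest_cons w)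
      (mem_hexRest_star w) hcon
    obtain ⟨e2⟩ := Suspension.nonempty_congr e'
    exact ⟨e1.trans e2⟩

lemma hexSpace_contractible (hs : ∀ p, sure p = true → p ∈ T)
    (hp : ∀ p ∈ T, poss p = true) {D : List (ℕ × ℕ)} (ms : List ((ℕ × ℕ) × (ℕ × ℕ))) (u : ℕ × ℕ)
    (h : peelsToIsolated sure poss D ms u = true) : ContractibleSpace (hexSpace T D) := by
  obtain ⟨D', hD', h'⟩ := (Option.any_eq_true _ _).1 h
  simp only [Bool.and_eq_true] at h'
  have hc : ContractibleSpace (hexSpace T D') :=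
    indReal_contractibleSpace (mem_of_remains hs h'.1) fun x hx hux =>
      List.not_mem_nil (mem_of_neighborsWithin hp h'.2 hx hux)
  obtain ⟨e⟩ := hexSpace_peel hs hp ms D D' hD' (Y := hexSpace T D')
    ⟨ContinuousMap.HomotopyEquiv.refl _⟩
  have := iteratedSuspension_contractibleSpace (hexSpace T D') ms.length
  exact e.contractibleSpace

lemma hexSpace_cut (hs : ∀ p, sure p = true → p ∈ T)
    (hp : ∀ p ∈ T, poss p = true) {Y : TopCat.{0}} {D : List (ℕ × ℕ)} (ms : List ((ℕ × ℕ) × (ℕ × ℕ)))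
    (c : ℕ → ℕ) (hT : ∀ p ∈ T, 1 ≤ p.1 ∧ p.1 ≤ 3)
    (h : peelsToCut sure poss D ms c = true)
    (e : Nonempty (indReal hexStrip (T.filter fun p => c p.1 < p.2) ≃ₕ Y)) :
    Nonempty (hexSpace T D ≃ₕ iteratedSuspension Y ms.length) := by
  obtain ⟨D', hD', h'⟩ := (Option.any_eq_true _ _).1 h
  simp only [Bool.and_eq_true] at h'
  refine hexSpace_peel hs hp ms D D' hD' ?_
  -- The list `D'` may contain labels outside `T`, so it agrees with the cut only within `T`.
  have : hexRest T D' = T.filter fun p => c p.1 < p.2 := by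
    refine Finset.filter_congr fun p hpT => ⟨fun hpD => ?_, fun hlt hpD => ?_⟩
    · by_contra hle
      have h1 := List.all_eq_true.1 h'.2 p.1 (by have := hT p hpT; simp; omega)
      have h2 := List.all_eq_true.1 h1 p.2 (by simp; omega)
      simp [hp p hpT, hpD] at h2
    · have h1 := List.all_eq_true.1 h'.1 p hpD
      simp [hp p hpT] at h1
      omega
  rw [hexSpace, this]
  exact e

/-- As `l` consists of neighbors of `v`, removing it from the deletion keeps the whole link; what
remains is the intermediate subcomplex whose contractibility makes the inclusion null-homotopic. -/
lemma hexSpace_wedge (hs : ∀ p, sure p = true → p ∈ T) {D : List (ℕ × ℕ)} (v : ℕ × ℕ) (l : List (ℕ × ℕ))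
    (h : splitsAt sure D v l = true)
    (hc : ContractibleSpace (hexSpace T (l ++ v :: D))) {P : PointedSpace}
    (hP : PathConnectedSpace P.space) {M : TopCat.{0}}
    (eA : Nonempty (hexSpace T (v :: D) ≃ₕ P.space))
    (eL : Nonempty (hexSpace T (v :: hexNeighbors v ++ D) ≃ₕ M)) :
    Nonempty (hexSpace T D ≃ₕ (wedge P (suspensionPointed M)).space) := by
  obtain ⟨eA⟩ := eA
  obtain ⟨eL⟩ := eL
  rw [splitsAt, Bool.and_eq_true] at h
  refine indReal_wedge (W := hexRest T (l ++ v :: D)) (mem_of_remains hs h.1) (mem_hexRest_cons v)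
    (mem_hexRest_star v) (fun w hw => ?_) (fun w hw => ?_) hc eA eL
  · obtain ⟨h1, h2, h3⟩ := (mem_hexRest_star v w).1 hw
    have h4 : w ∉ l := fun hwl => h3 ((hexStrip_adj_iff v w).2 (List.all_eq_true.1 h.2 w hwl))
    rw [mem_hexRest] at h1 ⊢
    simp [h1, h2, h4]
  · rw [mem_hexRest] at hw ⊢
    exact ⟨hw.1, fun hm => hw.2 (List.mem_append_right _ hm)⟩

lemma hexSpace_deletion (hs : ∀ p, sure p = true → p ∈ T) {D : List (ℕ × ℕ)} (v : ℕ × ℕ) (h : remains sure D v = true)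
    (hc : ContractibleSpace (hexSpace T (v :: hexNeighbors v ++ D))) :
    Nonempty (hexSpace T D ≃ₕ hexSpace T (v :: D)) :=
  indReal_deletion (mem_of_remains hs h) (mem_hexRest_cons v) (mem_hexRest_star v) hc

end Peel

/-! ### The double hexagonal strip of length `n` -/

/-- A computable form of membership in `hexVertices 2 n`. -/
def hexMem (n : ℕ) (p : ℕ × ℕ) : Bool :=
  decide (1 ≤ p.1) && decide (p.1 ≤ 3) && decide (1 ≤ p.2) &&
    (decide (p.2 ≤ 2 * n + 2) && (p.1 == 2 || decide (p.2 ≤ 2 * n + 1)))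

/-- A computable form of membership in the half-infinite double hexagonal strip. -/
def hexMemInfinite (p : ℕ × ℕ) : Bool := decide (1 ≤ p.1) && decide (p.1 ≤ 3) && decide (1 ≤ p.2)

lemma mem_hexVertices_two (n : ℕ) (p : ℕ × ℕ) : p ∈ hexVertices 2 n ↔
    (1 ≤ p.1 ∧ p.1 ≤ 3) ∧ 1 ≤ p.2 ∧ p.2 ≤ 2 * n + 2 ∧ (p.1 = 2 ∨ p.2 ≤ 2 * n + 1) := by
  rw [hexVertices, Finset.mem_filter, Finset.mem_product, Finset.mem_Icc, Finset.mem_Icc,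
    hexRowLength]
  split_ifs <;> omega

lemma hexMem_iff (n : ℕ) (p : ℕ × ℕ) : hexMem n p = true ↔ p ∈ hexVertices 2 n := by
  simp [hexMem, mem_hexVertices_two, and_assoc]

lemma mem_of_hexMem_four {n : ℕ} (hn : 4 ≤ n) (p : ℕ × ℕ) (h : hexMem 4 p = true) :
    p ∈ hexVertices 2 n := by
  rw [hexMem_iff, mem_hexVertices_two] at h
  rw [mem_hexVertices_two]
  omega

lemma hexMemInfinite_of_mem {n : ℕ} (p : ℕ × ℕ) (h : p ∈ hexVertices 2 n) :
    hexMemInfinite p = true := by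
  rw [mem_hexVertices_two] at h
  simp [hexMemInfinite, h]

lemma hexGrid_adj_iff (n : ℕ) (u w : hexVertices 2 n) :
    (hexGrid 2 n).Adj u w ↔ hexStrip.Adj u.1 w.1 := by
  rw [hexGrid, hexStrip, SimpleGraph.fromRel_adj, SimpleGraph.fromRel_adj, ne_eq, ne_eq,
    Subtype.ext_iff]

/-- Only even shifts are allowed, since the edges between rows depend on the parity of the column.
-/
lemma hexRel_shift_iff (k : ℕ) (p q : ℕ × ℕ) :
    hexRel 2 p q ↔ hexRel 2 (p.1, p.2 + 2 * k) (q.1, q.2 + 2 * k) := by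
  simp only [hexRel, Nat.odd_iff]
  exact or_congr (by omega) (or_congr (by omega) (by omega))

lemma hexStrip_shift_iff (k : ℕ) (p q : ℕ × ℕ) :
    hexStrip.Adj p q ↔ hexStrip.Adj (p.1, p.2 + 2 * k) (q.1, q.2 + 2 * k) := by
  rw [hexStrip, SimpleGraph.fromRel_adj, SimpleGraph.fromRel_adj, ← hexRel_shift_iff,
    ← hexRel_shift_iff, ne_eq, ne_eq, Prod.ext_iff, Prod.ext_iff, Nat.add_right_cancel_iff]

/-- The rotation by a half turn of the strip of length `n`. -/
def hexRotate (n : ℕ) (p : ℕ × ℕ) : ℕ × ℕ :=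
  (4 - p.1, if p.1 = 2 then 2 * n + 3 - p.2 else 2 * n + 2 - p.2)

lemma hexRotate_snd (n : ℕ) (p : ℕ × ℕ) : p.1 = 2 ∧ (hexRotate n p).2 = 2 * n + 3 - p.2 ∨
    p.1 ≠ 2 ∧ (hexRotate n p).2 = 2 * n + 2 - p.2 := by
  by_cases h : p.1 = 2 <;> simp [hexRotate, h]

lemma hexRotate_mem {n : ℕ} {p : ℕ × ℕ} (hp : p ∈ hexVertices 2 n) :
    hexRotate n p ∈ hexVertices 2 n := by
  rw [mem_hexVertices_two] at hp ⊢
  have h1 : (hexRotate n p).1 = 4 - p.1 := rfl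
  have h2 := hexRotate_snd n p
  omega

lemma hexRotate_hexRotate {n : ℕ} {p : ℕ × ℕ} (hp : p ∈ hexVertices 2 n) :
    hexRotate n (hexRotate n p) = p := by
  rw [mem_hexVertices_two] at hp
  have h1 : (hexRotate n p).1 = 4 - p.1 := rfl
  have h1' : (hexRotate n (hexRotate n p)).1 = 4 - (hexRotate n p).1 := rfl
  have h2 := hexRotate_snd n p
  have h2' := hexRotate_snd n (hexRotate n p)
  exact Prod.ext (by omega) (by omega)

/-- The half turn reverses each row, hence the exchange of `p` and `q`, and interchanges the edges
between rows 1 and 2 with those between rows 2 and 3. -/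
lemma hexRel_rotate {n : ℕ} {p q : ℕ × ℕ} (hp : p ∈ hexVertices 2 n)
    (hq : q ∈ hexVertices 2 n) (h : hexRel 2 p q) :
    hexRel 2 (hexRotate n q) (hexRotate n p) := by
  rw [mem_hexVertices_two] at hp hq
  have hp1 : (hexRotate n p).1 = 4 - p.1 := rfl
  have hq1 : (hexRotate n q).1 = 4 - q.1 := rfl
  have hp2 := hexRotate_snd n p
  have hq2 := hexRotate_snd n q
  simp only [hexRel, Nat.odd_iff] at h ⊢
  rcases h with h | h | h
  · left
    omega
  · right; right
    omega
  · right; left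
    omega

lemma hexRotate_adj {n : ℕ} {p q : ℕ × ℕ} (hp : p ∈ hexVertices 2 n)
    (hq : q ∈ hexVertices 2 n) (h : hexStrip.Adj p q) :
    hexStrip.Adj (hexRotate n p) (hexRotate n q) := by
  rw [hexStrip, SimpleGraph.fromRel_adj] at h ⊢
  refine ⟨fun he => h.1 ?_, h.2.symm.imp (hexRel_rotate hq hp) (hexRel_rotate hp hq)⟩
  rw [← hexRotate_hexRotate hp, he, hexRotate_hexRotate hq]

lemma hexRotate_adj_iff {n : ℕ} {p q : ℕ × ℕ} (hp : p ∈ hexVertices 2 n)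
    (hq : q ∈ hexVertices 2 n) :
    hexStrip.Adj p q ↔ hexStrip.Adj (hexRotate n p) (hexRotate n q) := by
  refine ⟨hexRotate_adj hp hq, fun h => ?_⟩
  have := hexRotate_adj (hexRotate_mem hp) (hexRotate_mem hq) h
  rwa [hexRotate_hexRotate hp, hexRotate_hexRotate hq] at this

/-- Cutting off `k` double hexagons from the strip of length `m + k` leaves the strip of
length `m`. -/
lemma indSpace_hexGrid_equiv (m k : ℕ) (c : ℕ → ℕ) (hc : ∀ i, 1 ≤ i → i ≤ 3 → c i = 2 * k) :
    Nonempty (indReal hexStrip ((hexVertices 2 (m + k)).filter fun p => c p.1 < p.2) ≃ₕ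
      IndSpace (hexGrid 2 m)) := by
  refine ⟨(indSpaceHomeo (hexGrid 2 m) hexStrip _ (fun w => (w.1.1, w.1.2 + 2 * k))
    (fun u w h => ?_) (fun p => ?_) fun u w => ?_).symm.toHomotopyEquiv⟩
  · simp only [Prod.mk.injEq, Nat.add_right_cancel_iff] at h
    exact Subtype.ext (Prod.ext h.1 h.2)
  · rw [Finset.mem_filter, mem_hexVertices_two]
    constructor
    · rintro ⟨⟨⟨h1, h2⟩, h3, h4⟩, h5⟩
      rw [hc _ h1 h2] at h5
      refine ⟨⟨(p.1, p.2 - 2 * k), ?_⟩, Prod.ext rfl ?_⟩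
      · rw [mem_hexVertices_two]
        simp only
        omega
      · simp only
        omega
    · rintro ⟨⟨w, hw⟩, rfl⟩
      rw [mem_hexVertices_two] at hw
      simp only
      rw [hc _ hw.1.1 hw.1.2]
      omega
  · rw [hexGrid_adj_iff]
    exact hexStrip_shift_iff k _ _

/-- Cutting off `k` double hexagons and the following hexagon in one of the rows from the strip of
length `m + k` leaves a rotated copy of `graphY m`. -/
lemma indSpace_graphY_equiv (m k : ℕ) (c : ℕ → ℕ)
    (hc : ∀ i, 1 ≤ i → i ≤ 3 → c i + 1 = 2 * k + i) :
    Nonempty (indReal hexStrip ((hexVertices 2 (m + k)).filter fun p => c p.1 < p.2) ≃ₕ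
      IndSpace (graphY m)) := by
  have hsub : ∀ w : graphYVertices m, w.1.1 ∈ hexVertices 2 (m + k) := fun w => by
    have hw := w.1.2
    rw [mem_hexVertices_two] at hw ⊢
    omega
  -- Rows 1, 2, 3 lose their first `2k`, `2k + 1`, `2k + 2` vertices. After the half turn of the
  -- long strip, rows 1, 2, 3 keep their first `2m - 1`, `2m + 1`, `2m + 1` vertices, which is
  -- `graphY m`.
  refine ⟨(indSpaceHomeo (graphY m) hexStrip _ (fun w => hexRotate (m + k) w.1.1)
    (fun u w h => ?_) (fun p => ?_) fun u w => ?_).symm.toHomotopyEquiv⟩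
  · have := congrArg (hexRotate (m + k)) h
    simp only [hexRotate_hexRotate (hsub _)] at this
    exact Subtype.ext (Subtype.ext this)
  · rw [Finset.mem_filter]
    constructor
    · rintro ⟨hp, h5⟩
      have hp' := (mem_hexVertices_two _ _).1 hp
      have hcp := hc _ hp'.1.1 hp'.1.2
      have h1 : (hexRotate (m + k) p).1 = 4 - p.1 := rfl
      have h2 := hexRotate_snd (m + k) p
      have hq : hexRotate (m + k) p ∈ hexVertices 2 m := by
        rw [mem_hexVertices_two]
        omega
      refine ⟨⟨⟨_, hq⟩, ?_, ?_, ?_⟩, hexRotate_hexRotate hp⟩ <;>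
        simp only [ne_eq, Prod.ext_iff] <;> omega
    · rintro ⟨w, rfl⟩
      refine ⟨hexRotate_mem (hsub w), ?_⟩
      obtain ⟨⟨⟨i, r⟩, hw⟩, h1, h2, h3⟩ := w
      rw [mem_hexVertices_two] at hw
      simp only [ne_eq, Prod.mk.injEq] at h1 h2 h3
      have hcp := hc (4 - i) (by omega) (by omega)
      have h4 : (hexRotate (m + k) (i, r)).1 = 4 - i := rfl
      have h5 := hexRotate_snd (m + k) (i, r)
      simp only at hw hcp h5 ⊢
      rw [h4]
      omega
  · rw [← hexRotate_adj_iff (hsub u) (hsub w), ← hexGrid_adj_iff]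
    rfl

lemma indSpace_hexGrid_equiv_hexSpace (n : ℕ) :
    Nonempty (IndSpace (hexGrid 2 n) ≃ₕ hexSpace (hexVertices 2 n) []) := by
  obtain ⟨e⟩ := indSpace_hexGrid_equiv n 0 (fun _ => 0) (fun _ _ _ => rfl)
  have : ((hexVertices 2 (n + 0)).filter fun p => 0 < p.2) = hexRest (hexVertices 2 n) [] := by
    rw [hexRest]
    refine Finset.filter_congr fun p hp => ?_
    have := ((mem_hexVertices_two _ _).1 hp).2.1
    simp
    omega
  rw [this] at e
  exact ⟨e.symm⟩

/-! ### The strips of length 1, 2 and 3 -/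

section Small

variable {n : ℕ}

/-- The cut `2 * n + 2` exceeds no row length from below, so nothing remains after peeling; each
move then contributes one suspension of the empty space. -/
lemma hexSpace_sphere {D : List (ℕ × ℕ)} (d : ℕ) (ms : List ((ℕ × ℕ) × (ℕ × ℕ)))
    (hd : ms.length = d + 1)
    (h : peelsToCut (hexMem n) (hexMem n) D ms (fun _ => 2 * n + 2) = true) :
    Nonempty (hexSpace (hexVertices 2 n) D ≃ₕ (pointedSphere d).space) := by
  have hE : ((hexVertices 2 n).filter fun p => 2 * n + 2 < p.2) = ∅ :=
    Finset.filter_eq_empty_iff.2 fun p hp => by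
      have := ((mem_hexVertices_two _ _).1 hp).2.2
      omega
  obtain ⟨e⟩ := hexSpace_cut (Y := TopCat.of (indReal hexStrip (∅ : Finset (ℕ × ℕ))))
    (fun p => (hexMem_iff n p).1) (fun p => (hexMem_iff n p).2) ms _
    (fun p hp => ((mem_hexVertices_two _ _).1 hp).1) h
    (by rw [hE]; exact ⟨ContinuousMap.HomotopyEquiv.refl _⟩)
  have : IsEmpty (TopCat.of (indReal hexStrip (∅ : Finset (ℕ × ℕ)))) :=
    inferInstanceAs (IsEmpty (indReal hexStrip (∅ : Finset (ℕ × ℕ))))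
  rw [hd] at e
  obtain ⟨e'⟩ := iteratedSuspension_empty (TopCat.of (indReal hexStrip (∅ : Finset (ℕ × ℕ)))) d
  exact ⟨e.trans e'⟩

lemma hexSpace_wedge_sphere {D : List (ℕ × ℕ)} (v : ℕ × ℕ) (l : List (ℕ × ℕ)) (d : ℕ)
    (h : splitsAt (hexMem n) D v l = true) (ms : List ((ℕ × ℕ) × (ℕ × ℕ))) (u : ℕ × ℕ)
    (hc : peelsToIsolated (hexMem n) (hexMem n) (l ++ v :: D) ms u = true) {P : PointedSpace}
    (hP : PathConnectedSpace P.space)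
    (eA : Nonempty (hexSpace (hexVertices 2 n) (v :: D) ≃ₕ P.space))
    (eL : Nonempty (hexSpace (hexVertices 2 n) (v :: hexNeighbors v ++ D) ≃ₕ
      (pointedSphere d).space)) :
    Nonempty (hexSpace (hexVertices 2 n) D ≃ₕ (wedge P (pointedSphere (d + 1))).space) := by
  have hs := fun p => (hexMem_iff n p).1
  obtain ⟨e⟩ := hexSpace_wedge hs v l h
    (hexSpace_contractible hs (fun p => (hexMem_iff n p).2) ms u hc) hP eA eL
  exact ⟨e.trans (wedgeCongrRight P (suspensionSphereHomeo d)
    (suspensionSphereHomeo_pt d)).toHomotopyEquiv⟩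

lemma indSpace_hexGrid_one : Nonempty (IndSpace (hexGrid 2 1) ≃ₕ
    (wedge (pointedSphere 2) (pointedSphere 2)).space) := by
  obtain ⟨e⟩ := indSpace_hexGrid_equiv_hexSpace 1
  obtain ⟨e'⟩ := hexSpace_wedge_sphere (n := 1) (D := []) (1, 2) [(1, 3)] 1 (by decide +kernel)
    [((1, 1), (2, 2)), ((3, 1), (3, 2))] (2, 4) (by decide +kernel) (pointedSphere_pathConnectedSpace 1)
    (hexSpace_sphere 2 [((1, 1), (2, 2)), ((3, 1), (3, 2)), ((1, 3), (2, 4))] rfl (by decide +kernel))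
    (hexSpace_sphere 1 [((2, 4), (2, 3)), ((2, 1), (3, 1))] rfl (by decide +kernel))
  exact ⟨e.trans e'⟩

lemma indSpace_hexGrid_two : Nonempty (IndSpace (hexGrid 2 2) ≃ₕ
    (wedge (wedge (pointedSphere 4) (pointedSphere 4)) (pointedSphere 4)).space) := by
  obtain ⟨e⟩ := indSpace_hexGrid_equiv_hexSpace 2
  have := pointedSphere_pathConnectedSpace 3
  -- The deletion of `(2, 3)` is itself split, at `(2, 1)`; it accounts for two of the three
  -- spheres.
  have eA := hexSpace_wedge_sphere (n := 2) (D := [(2, 3)]) (2, 1) [(2, 2)] 3 (by decide +kernel)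
    [((1, 1), (1, 2)), ((3, 1), (3, 2)), ((1, 4), (1, 5)), ((2, 4), (2, 5))] (3, 4) (by decide +kernel) this
    (hexSpace_sphere 4 [((3, 1), (3, 2)), ((2, 2), (1, 1)), ((3, 4), (3, 5)), ((2, 4), (1, 3)),
      ((1, 5), (2, 6))] rfl (by decide +kernel))
    (hexSpace_sphere 3 [((1, 1), (1, 2)), ((3, 2), (3, 3)), ((1, 4), (1, 5)), ((2, 4), (2, 5))] rfl
      (by decide +kernel))
  obtain ⟨e'⟩ := hexSpace_wedge_sphere (n := 2) (D := []) (2, 3) [(2, 2), (2, 4)] 3 (by decide +kernel)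
    [((1, 1), (1, 2)), ((2, 1), (3, 1)), ((3, 3), (3, 4)), ((1, 4), (1, 5))] (2, 5) (by decide +kernel)
    (wedge_pathConnectedSpace _ _) eA
    (hexSpace_sphere 3 [((1, 1), (1, 2)), ((2, 1), (3, 1)), ((1, 4), (1, 5)), ((3, 4), (3, 5))] rfl
      (by decide +kernel))
  exact ⟨e.trans e'⟩

lemma indSpace_hexGrid_three : Nonempty (IndSpace (hexGrid 2 3) ≃ₕ
    (wedge (pointedSphere 5) (pointedSphere 6)).space) := by
  obtain ⟨e⟩ := indSpace_hexGrid_equiv_hexSpace 3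
  have hs := fun p => (hexMem_iff 3 p).1
  -- After four moves the link of `(2, 3)` is reduced to a path on four vertices, whose complex is
  -- contractible; the fifth move isolates `(3, 7)`. Hence `(2, 3)` can be deleted without adding a
  -- summand.
  obtain ⟨e1⟩ := hexSpace_deletion (D := []) hs (2, 3) (by decide +kernel)
    (hexSpace_contractible hs (fun p => (hexMem_iff 3 p).2)
      [((1, 1), (1, 2)), ((2, 1), (3, 1)), ((1, 4), (1, 5)), ((3, 4), (3, 5)), ((1, 7), (2, 8))]
      (3, 7) (by decide +kernel))
  obtain ⟨e2⟩ := hexSpace_wedge_sphere (n := 3) (D := [(2, 3)]) (2, 1) [(2, 2)] 5 (by decide +kernel)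
    [((1, 1), (1, 2)), ((3, 1), (3, 2)), ((1, 4), (1, 5)), ((2, 4), (2, 5))] (3, 4) (by decide +kernel)
    (pointedSphere_pathConnectedSpace 4)
    (hexSpace_sphere 5 [((3, 1), (3, 2)), ((2, 2), (1, 1)), ((3, 4), (3, 5)), ((2, 4), (1, 3)),
      ((3, 7), (2, 7)), ((1, 5), (1, 6))] rfl (by decide +kernel))
    (hexSpace_sphere 5 [((1, 1), (1, 2)), ((3, 2), (3, 3)), ((1, 4), (1, 5)), ((2, 4), (2, 5)),
      ((3, 6), (3, 7)), ((1, 7), (2, 8))] rfl (by decide +kernel))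
  exact ⟨(e.trans e1).trans e2⟩

end Small

instance indSpace_nonempty {V : Type} [Fintype V] [DecidableEq V] [h : Nonempty V]
    (G : SimpleGraph V) : Nonempty (IndSpace G) := by
  obtain ⟨v⟩ := h
  refine ⟨⟨Pi.single v 1, single_mem_stdSimplex ℝ v, {v}, ?_, fun w hw => ?_⟩⟩
  · exact ⟨Finset.singleton_nonempty v, by simp [SimpleGraph.IsIndepSet]⟩
  · by_contra h
    exact hw (Pi.single_eq_of_ne (by simpa using h) _)

lemma graphYVertices_nonempty (n : ℕ) : Nonempty (graphYVertices n) :=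
  ⟨⟨⟨(3, 1), by rw [mem_hexVertices_two]; simp⟩, by simp [graphYVertices]⟩⟩

/-! ### The strips of length at least 4 -/

section Large

variable {n : ℕ} {sure poss : ℕ × ℕ → Bool}

lemma hexSpace_iteratedSuspension (hs : ∀ p, sure p = true → p ∈ hexVertices 2 n)
    (hp : ∀ p ∈ hexVertices 2 n, poss p = true) {Y : TopCat.{0}} {D : List (ℕ × ℕ)}
    (ms : List ((ℕ × ℕ) × (ℕ × ℕ))) (c : ℕ → ℕ) (k : ℕ) (hk : ms.length = k)
    (h : peelsToCut sure poss D ms c = true)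
    (e : Nonempty (indReal hexStrip ((hexVertices 2 n).filter fun p => c p.1 < p.2) ≃ₕ Y)) :
    Nonempty (hexSpace (hexVertices 2 n) D ≃ₕ iteratedSuspension Y k) := by
  subst hk
  exact hexSpace_cut hs hp ms c (fun p hp => ((mem_hexVertices_two _ _).1 hp).1) h e

/-- The additional suspension comes from the mapping cone; its pole `false` is by definition the
base point of `pointedSuspension (k + 1) X`. -/
lemma hexSpace_wedge_suspension (hs : ∀ p, sure p = true → p ∈ hexVertices 2 n)
    (hp : ∀ p ∈ hexVertices 2 n, poss p = true) {D : List (ℕ × ℕ)} (v : ℕ × ℕ)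
    (l : List (ℕ × ℕ)) (h : splitsAt sure D v l = true) (ms : List ((ℕ × ℕ) × (ℕ × ℕ)))
    (u : ℕ × ℕ) (hc : peelsToIsolated sure poss (l ++ v :: D) ms u = true) {P : PointedSpace}
    (hP : PathConnectedSpace P.space)
    (eA : Nonempty (hexSpace (hexVertices 2 n) (v :: D) ≃ₕ P.space)) {X : TopCat.{0}} (k : ℕ)
    (eL : Nonempty (hexSpace (hexVertices 2 n) (v :: hexNeighbors v ++ D) ≃ₕ
      iteratedSuspension X k)) :
    Nonempty (hexSpace (hexVertices 2 n) D ≃ₕ (wedge P (pointedSuspension (k + 1) X)).space) :=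
  hexSpace_wedge hs v l h (hexSpace_contractible hs hp ms u hc) hP eA eL

lemma indSpace_hexGrid_of_four_le {n : ℕ} (hn : 4 ≤ n) : Nonempty (IndSpace (hexGrid 2 n) ≃ₕ
    (wedge (wedge (pointedSuspension 6 (IndSpace (graphY (n - 3))))
      (pointedSuspension 4 (IndSpace (graphY (n - 2)))))
      (pointedSuspension 5 (IndSpace (hexGrid 2 (n - 3))))).space) := by
  obtain ⟨e⟩ := indSpace_hexGrid_equiv_hexSpace n
  -- Vertices used by the moves are checked to lie in the strip of length 4, absent neighbors
  -- against the half-infinite strip; this makes the computations independent of `n`.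
  have hs := mem_of_hexMem_four hn
  have hp := hexMemInfinite_of_mem (n := n)
  have := graphYVertices_nonempty (n - 3)
  have := graphYVertices_nonempty (n - 2)
  have hP : PathConnectedSpace (pointedSuspension 6 (IndSpace (graphY (n - 3)))).space :=
    iteratedSuspension_pathConnectedSpace _ 5
  have hQ : PathConnectedSpace (pointedSuspension 4 (IndSpace (graphY (n - 2)))).space :=
    iteratedSuspension_pathConnectedSpace _ 3
  -- The cuts are `2k + i - 1` in row `i`: `i + 5` for `k = 3` and `i + 3` for `k = 2`.
  have yA := indSpace_graphY_equiv (n - 3) 3 (fun i => i + 5) (fun i _ _ => by omega)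
  have yL := indSpace_graphY_equiv (n - 2) 2 (fun i => i + 3) (fun i _ _ => by omega)
  have hL := indSpace_hexGrid_equiv (n - 3) 3 (fun _ => 6) (fun i _ _ => by omega)
  rw [show n - 3 + 3 = n by omega] at yA hL
  rw [show n - 2 + 2 = n by omega] at yL
  have hPQ : PathConnectedSpace (wedge (pointedSuspension 6 (IndSpace (graphY (n - 3))))
      (pointedSuspension 4 (IndSpace (graphY (n - 2))))).space := wedge_pathConnectedSpace _ _
  have e1 : Nonempty (hexSpace (hexVertices 2 n) [(2, 2), (2, 3)] ≃ₕ
      iteratedSuspension (IndSpace (graphY (n - 3))) 6) :=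
    hexSpace_iteratedSuspension hs hp [((1, 1), (1, 2)), ((2, 1), (3, 1)), ((3, 3), (3, 4)),
      ((1, 4), (1, 5)), ((2, 4), (2, 5)), ((3, 6), (3, 7))] (fun i => i + 5) 6 rfl (by decide +kernel) yA
  have e2 : Nonempty (hexSpace (hexVertices 2 n) ((2, 2) :: hexNeighbors (2, 2) ++ [(2, 3)]) ≃ₕ
      iteratedSuspension (IndSpace (graphY (n - 2))) 3) :=
    hexSpace_iteratedSuspension hs hp [((3, 1), (3, 2)), ((1, 2), (1, 3)), ((3, 4), (3, 5))]
      (fun i => i + 3) 3 rfl (by decide +kernel) yL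
  have e3 : Nonempty (hexSpace (hexVertices 2 n) ((2, 3) :: hexNeighbors (2, 3) ++ []) ≃ₕ
      iteratedSuspension (IndSpace (hexGrid 2 (n - 3))) 4) :=
    hexSpace_iteratedSuspension hs hp [((1, 1), (1, 2)), ((2, 1), (3, 1)), ((1, 4), (1, 5)),
      ((3, 4), (3, 5))] (fun _ => 6) 4 rfl (by decide +kernel) hL
  -- Also removing the neighbor `(2, 1)` of `(2, 2)` gives a subgraph that peels until `(3, 4)` is
  -- isolated, so the link of `(2, 2)` is null-homotopic in its deletion. For `(2, 3)` below,
  -- removing `(2, 2)` and `(2, 4)` plays this role and isolates `(2, 5)`.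
  have e4 := hexSpace_wedge_suspension hs hp (2, 2) [(2, 1)] (by decide +kernel)
    [((1, 1), (1, 2)), ((3, 1), (3, 2)), ((1, 4), (1, 5)), ((2, 4), (2, 5))] (3, 4)
    (by decide +kernel) hP e1 3 e2
  obtain ⟨e5⟩ := hexSpace_wedge_suspension hs hp (2, 3) [(2, 2), (2, 4)] (by decide +kernel)
    [((1, 1), (1, 2)), ((2, 1), (3, 1)), ((3, 3), (3, 4)), ((1, 4), (1, 5))] (2, 5)
    (by decide +kernel) hPQ e4 4 e3
  exact ⟨e.trans e5⟩

end Large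

theorem mainTheorem2 (n : ℕ) (hn : 1 ≤ n) :
    (n = 1 →
      Nonempty (IndSpace (hexGrid 2 n) ≃ₕ
        (wedge (pointedSphere 2) (pointedSphere 2)).space)) ∧
    (n = 2 →
      Nonempty (IndSpace (hexGrid 2 n) ≃ₕ
        (wedge (wedge (pointedSphere 4) (pointedSphere 4)) (pointedSphere 4)).space)) ∧
    (n = 3 →
      Nonempty (IndSpace (hexGrid 2 n) ≃ₕ
        (wedge (pointedSphere 5) (pointedSphere 6)).space)) ∧
    (4 ≤ n →
      Nonempty (IndSpace (hexGrid 2 n) ≃ₕ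
        (wedge
          (wedge (pointedSuspension 6 (IndSpace (graphY (n - 3))))
            (pointedSuspension 4 (IndSpace (graphY (n - 2)))))
          (pointedSuspension 5 (IndSpace (hexGrid 2 (n - 3))))).space)) := by
  refine ⟨?_, ?_, ?_, indSpace_hexGrid_of_four_le⟩
  · rintro rfl
    exact indSpace_hexGrid_one
  · rintro rfl
    exact indSpace_hexGrid_two
  · rintro rfl
    exact indSpace_hexGrid_three
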